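/- Let $n\ge p\ge 1$ and $\ell\ge 2$ be integers and let $\mathrm{St}(n,p)=\{X\in\mathbb R^{n\times p}: X^\top X=I\}$. Here $\|\cdot\|$ and $\langle\cdot,\cdot\rangle$ are the Frobenius norm and inner product. Let $f:\mathbb R^{n\times p}\to\mathbb R$ be $\tau$-weakly convex (i.e. $f+\frac{\tau}{2}\|\cdot\|^2$ is convex) and $L$-Lipschitz on a bounded convex neighborhood of $\mathrm{St}(n,p)$, where $\tau\ge0$ and $L>0$, and let $\partial f$ be its Clarke subdifferential. Let $\mathfrak C=\{C_1,\dots,C_\ell\}$ be a partition of $[p]=\{1,\dots,p\}$. For $S\subseteq[p]$ let $X_S$ be the submatrix of the columns of $X$ with index in $S$ and let $I_S$ be the corresponding columns of the identity. Write $C_{ij}=C_i\cup C_j$, $X_{ij}=X_{C_{ij}}$, $X_{-ij}=X_{[p]\setminus C_{ij}}$, $I_{ij}=I_{C_{ij}}$. For $X\in \mathrm{St}(n,p)$ and $\{i,j\}\subseteq\{1,\dots,\ell\}$ with $i\ne j$, define the submanifold block $$\mathcal M_{X_{-ij}}=\{Y\in\mathrm{St}(n,|C_{ij}|): X_{-ij}^\top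 Y=0\}$$ with tangent space $$T_{X_{ij}}\mathcal M_{X_{-ij}}=\{\xi\in\mathbb R^{n\times|C_{ij}|}:\xi^\top X_{ij}+X_{ij}^\top\xi=0,\ X_{-ij}^\top\xi=0\}.$$ Define the averaging operator on $\mathbb R^{n\times p}$ $$\mathcal A_X(\xi)=\binom{\ell}{2}^{-1}\sum_{\{i,j\}}(I-X_{-ij}X_{-ij}^\top)\,\xi_{ij}\,I_{ij}^\top ,$$ which is self-adjoint and positive definite, and let $\|\xi\|_{\mathcal A_X^{-1}}=\sqrt{\langle\mathcal A_X^{-1}(\xi),\xi\rangle}$. For $\lambda>0$ put $$f^{\mathfrak C}_\lambda(X)=\min_{Y\in\mathrm{St}(n,p)}\Big\{f(Y)+\tfrac1{2\lambda}\|Y-X\|^2_{\mathcal A_X^{-1}}\Big\},\qquad P^{\mathfrak C}_{\lambda f}(X)=\operatorname*{argmin}_{Y\in\mathrm{St}(n,p)}\Big\{f(Y)+\tfrac1{2\lambda}\|Y-X\|^2_{\mathcal A_X^{-1}}\Big\},$$ and, where $P^{\mathfrak C}_{\lambda f}(X)$ is a single point, $\Theta^{\mathfrak C}_{\lambda f}(X)=\frac1\lambda\|P^{\mathfrak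 C}_{\lambda f}(X)-X\|_{\mathcal A_X^{-1}}$. Let $\{X^k\}_{k\ge0}$ be iterates of the randomized submanifold subgradient method (RSSM) with stepsizes $\gamma_k\in(0,\frac1L)$ for all $k\ge 0$: $X^0\in\mathrm{St}(n,p)$ is given. At each iteration $k$ a subgradient $\xi^k\in\partial f(X^k)$ is selected, possibly at random. An unordered pair $\{i,j\}$ of distinct indices in $\{1,\dots,\ell\}$ is drawn uniformly and independently of $\xi^k$ and of all the past. Then $$X^{k+1}_{ij}=\mathcal P_{\mathcal M_{X^k_{-ij}}}\Big(X^k_{ij}-\gamma_k\,\mathcal P_{T_{X^k_{ij}}\mathcal M_{X^k_{-ij}}}\big(\xi^kI_{ij}\big)\Big),\qquad X^{k+1}_{-ij}=X^k_{-ij},$$ where $\mathcal P_{\mathcal S}$ is the nearest-point projection onto $\mathcal S$. Then, for every $\lambda\in\big(0,\frac{\ell}{2(\tau+(2\ell-1)L)}\big)$ and every $k\ge0$, the map $P^{\mathfrak C}_{\lambda f}$ is single-valued on $\mathrm{St}(n,p)$, $f^{\mathfrak C}_\lambda(X^{k+1})$ is integrable, and almost surely $$\gamma_k\,\Theta^{\mathfrak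 C}_{\lambda f}(X^k)^2=\frac{\gamma_k}{\lambda^2}\big\|P^{\mathfrak C}_{\lambda f}(X^k)-X^k\big\|^2_{\mathcal A_{X^k}^{-1}}\le\frac{f^{\mathfrak C}_\lambda(X^k)-\mathbb E\big[f^{\mathfrak C}_\lambda(X^{k+1})\,\big|\,X^k\big]+\frac{9\gamma_k^2L^2}{2\lambda}+\frac{2(\ell-2)\gamma_k^3L^3}{\lambda}+\frac{(\ell-2)\gamma_k^4L^4}{2\lambda}}{\frac\lambda\ell\left[\frac{\ell}{2\lambda}-(\tau+(2\ell-3)L)\right]}.$$ -/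

import Mathlib

open scoped Matrix Matrix.Norms.Frobenius Topology
open MeasureTheory ProbabilityTheory Filter

noncomputable section

namespace RSSM

/-! In this file `‖A‖` is the Frobenius norm of a real matrix `A`. -/

/-- Matrices carry their Borel sigma-algebra. -/
instance instMeasurableSpaceMatrix {m ι : Type*} : MeasurableSpace (Matrix m ι ℝ) := borel _

instance instBorelSpaceMatrix {m ι : Type*} : BorelSpace (Matrix m ι ℝ) := ⟨rfl⟩

section Basic

variable {m ι : Type*} [Fintype m] [Fintype ι]

/-- The Frobenius inner product `⟨A, B⟩ = tr (Aᵀ B)`. -/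
def frobInner (A B : Matrix m ι ℝ) : ℝ := (Aᵀ * B).trace

/-- The Mahalanobis norm `‖A‖_D = √⟨D A, A⟩` of a linear operator `D` on matrices. -/
def mahalNorm (D : Module.End ℝ (Matrix m ι ℝ)) (A : Matrix m ι ℝ) : ℝ :=
  √(frobInner (D A) A)

/-- The projection of `A` onto `S`, as the set of all nearest points. -/
def proj (S : Set (Matrix m ι ℝ)) (A : Matrix m ι ℝ) : Set (Matrix m ι ℝ) :=
  {B | B ∈ S ∧ ‖A - B‖ = Metric.infDist A S}

/-- The Stiefel manifold of matrices with orthonormal columns. -/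
def Stiefel (m ι : Type*) [Fintype m] [DecidableEq ι] : Set (Matrix m ι ℝ) :=
  {X | Xᵀ * X = 1}

/-- `f` is `τ`-weakly convex on `U`. -/
def WeaklyConvexOn (τ : ℝ) (U : Set (Matrix m ι ℝ)) (f : Matrix m ι ℝ → ℝ) : Prop :=
  ConvexOn ℝ U fun X => f X + τ / 2 * ‖X‖ ^ 2

/-- The Clarke generalized directional derivative
`limsup_{Y → X, t ↓ 0} (f (Y + t V) - f Y) / t`, with values in the extended reals. -/
def clarkeDeriv (f : Matrix m ι ℝ → ℝ) (X V : Matrix m ι ℝ) : EReal :=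
  limsup (fun q : Matrix m ι ℝ × ℝ => (((f (q.1 + q.2 • V) - f q.1) / q.2 : ℝ) : EReal))
    (𝓝 X ×ˢ 𝓝[>] (0 : ℝ))

/-- The Clarke subdifferential. -/
def clarkeSubdiff (f : Matrix m ι ℝ → ℝ) (X : Matrix m ι ℝ) : Set (Matrix m ι ℝ) :=
  {ξ | ∀ V, ((frobInner ξ V : ℝ) : EReal) ≤ clarkeDeriv f X V}

end Basic

section Blocks

variable {n p ℓ : ℕ}

/-- The submatrix `X_S` of the columns of `X` with index in `S`. -/
def cols {m ι : Type*} (X : Matrix m ι ℝ) (S : Finset ι) : Matrix m S ℝ :=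
  X.submatrix id Subtype.val

/-- `C` is a partition of the set of column indices into `ℓ` blocks. -/
def IsPartition (C : Fin ℓ → Finset (Fin p)) : Prop :=
  (∀ i j, i ≠ j → Disjoint (C i) (C j)) ∧ ∀ a, ∃ i, a ∈ C i

/-- The unordered pairs `{i, j}` of distinct block indices. -/
abbrev BlockPair (ℓ : ℕ) : Type := {s : Finset (Fin ℓ) // s.card = 2}

/-- The column indices `C_i ∪ C_j` belonging to a pair `{i, j}` of blocks. -/
def pairCols (C : Fin ℓ → Finset (Fin p)) (s : BlockPair ℓ) : Finset (Fin p) :=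
  s.1.biUnion C

/-- The submanifold block at `X` with respect to the columns in `S`. -/
def submanifoldBlock (X : Matrix (Fin n) (Fin p) ℝ) (S : Finset (Fin p)) :
    Set (Matrix (Fin n) S ℝ) :=
  {Y | Y ∈ Stiefel (Fin n) S ∧ (cols X Sᶜ)ᵀ * Y = 0}

/-- The tangent space to the submanifold block at its point `X_S`. -/
def blockTangent (X : Matrix (Fin n) (Fin p) ℝ) (S : Finset (Fin p)) :
    Set (Matrix (Fin n) S ℝ) :=
  {ξ | ξᵀ * cols X S + (cols X S)ᵀ * ξ = 0 ∧ (cols X Sᶜ)ᵀ * ξ = 0}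

/-- The linear map `ξ ↦ (I - X_{Sᶜ} X_{Sᶜ}ᵀ) ξ_S I_Sᵀ`. -/
def blockOp (X : Matrix (Fin n) (Fin p) ℝ) (S : Finset (Fin p)) :
    Module.End ℝ (Matrix (Fin n) (Fin p) ℝ) where
  toFun ξ := (1 - cols X Sᶜ * (cols X Sᶜ)ᵀ) * cols ξ S * (cols (1 : Matrix (Fin p) (Fin p) ℝ) S)ᵀ
  map_add' ξ η := by
    have h : cols (ξ + η) S = cols ξ S + cols η S := rfl
    rw [h, Matrix.mul_add, Matrix.add_mul]
  map_smul' c ξ := by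
    have h : cols (c • ξ) S = c • cols ξ S := rfl
    rw [h, Matrix.mul_smul, Matrix.smul_mul, RingHom.id_apply]

/-- The averaging operator `𝒜_X`. -/
def avgOp (C : Fin ℓ → Finset (Fin p)) (X : Matrix (Fin n) (Fin p) ℝ) :
    Module.End ℝ (Matrix (Fin n) (Fin p) ℝ) :=
  ((ℓ.choose 2 : ℕ) : ℝ)⁻¹ • ∑ s : BlockPair ℓ, blockOp X (pairCols C s)

/-- The adaptive norm `‖ξ‖_{𝒜_X⁻¹}`; for `X` on the Stiefel manifold `𝒜_X` is invertible. -/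
def adaptiveNorm (C : Fin ℓ → Finset (Fin p)) (X ξ : Matrix (Fin n) (Fin p) ℝ) : ℝ :=
  mahalNorm (Ring.inverse (avgOp C X)) ξ

/-- The function `Y ↦ f Y + (1 / (2 λ)) ‖Y - X‖²_{𝒜_X⁻¹}`. -/
def proxObjective (C : Fin ℓ → Finset (Fin p)) (f : Matrix (Fin n) (Fin p) ℝ → ℝ) (lam : ℝ)
    (X Y : Matrix (Fin n) (Fin p) ℝ) : ℝ :=
  f Y + 1 / (2 * lam) * adaptiveNorm C X (Y - X) ^ 2

/-- The adaptive Moreau envelope. -/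
def envelope (C : Fin ℓ → Finset (Fin p)) (f : Matrix (Fin n) (Fin p) ℝ → ℝ) (lam : ℝ)
    (X : Matrix (Fin n) (Fin p) ℝ) : ℝ :=
  sInf (proxObjective C f lam X '' Stiefel (Fin n) (Fin p))

/-- The set of minimizers that defines the adaptive proximal map. -/
def proxSet (C : Fin ℓ → Finset (Fin p)) (f : Matrix (Fin n) (Fin p) ℝ → ℝ) (lam : ℝ)
    (X : Matrix (Fin n) (Fin p) ℝ) : Set (Matrix (Fin n) (Fin p) ℝ) :=
  {Y | Y ∈ Stiefel (Fin n) (Fin p) ∧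
    ∀ Z ∈ Stiefel (Fin n) (Fin p), proxObjective C f lam X Y ≤ proxObjective C f lam X Z}

/-- The adaptive proximal map (the element of `proxSet`, where that set is a singleton). -/
def prox (C : Fin ℓ → Finset (Fin p)) (f : Matrix (Fin n) (Fin p) ℝ → ℝ) (lam : ℝ)
    (X : Matrix (Fin n) (Fin p) ℝ) : Matrix (Fin n) (Fin p) ℝ :=
  Classical.epsilon fun Y => Y ∈ proxSet C f lam X

/-- The surrogate stationarity measure `Θ`. -/
def surrogate (C : Fin ℓ → Finset (Fin p)) (f : Matrix (Fin n) (Fin p) ℝ → ℝ) (lam : ℝ)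
    (X : Matrix (Fin n) (Fin p) ℝ) : ℝ :=
  1 / lam * adaptiveNorm C X (prox C f lam X - X)

/-- One iteration from `X` to `X'` with stepsize `γ`, the Euclidean subgradient `ξ` at `X` and the
pair of blocks `s`: with `S` the columns of the pair, `ζ` is the partial Riemannian subgradient
(the orthogonal projection of the partial Euclidean subgradient `ξ_S = ξ I_S` onto the tangent
space), the columns in `S` are replaced by the projection of `X_S - γ ζ` onto the submanifold
block, and the other columns are kept. -/
def IsStep (C : Fin ℓ → Finset (Fin p)) (γ : ℝ) (X ξ : Matrix (Fin n) (Fin p) ℝ)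
    (s : BlockPair ℓ) (X' : Matrix (Fin n) (Fin p) ℝ) : Prop :=
  ∃ ζ ∈ proj (blockTangent X (pairCols C s)) (cols ξ (pairCols C s)),
    cols X' (pairCols C s) ∈
      proj (submanifoldBlock X (pairCols C s)) (cols X (pairCols C s) - γ • ζ) ∧
    cols X' (pairCols C s)ᶜ = cols X (pairCols C s)ᶜ

/-- The information available when the `k`-th pair of blocks is drawn: the iterates and the
subgradients up to time `k` and the earlier pairs. -/
abbrev past {Ω : Type*} (X ξ : ℕ → Ω → Matrix (Fin n) (Fin p) ℝ) (pr : ℕ → Ω → BlockPair ℓ)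
    (k : ℕ) : MeasurableSpace Ω :=
  (⨆ j ≤ k, MeasurableSpace.comap (X j) inferInstance ⊔ MeasurableSpace.comap (ξ j) inferInstance)
    ⊔ ⨆ j < k, MeasurableSpace.comap (pr j) inferInstance

/-- `X` is a sequence of iterates of the randomized submanifold subgradient method for `f`, with
partition `C`, stepsizes `γ` and initial point `X₀`; `ξ k` is the Euclidean Clarke subgradient
used at iteration `k`, and `pr k` is the pair of blocks drawn at iteration `k`. -/
structure IsIterates {Ω : Type*} [MeasurableSpace Ω] (μ : Measure Ω)
    (f : Matrix (Fin n) (Fin p) ℝ → ℝ) (C : Fin ℓ → Finset (Fin p)) (γ : ℕ → ℝ)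
    (X₀ : Matrix (Fin n) (Fin p) ℝ) (X ξ : ℕ → Ω → Matrix (Fin n) (Fin p) ℝ)
    (pr : ℕ → Ω → BlockPair ℓ) : Prop where
  measurable_iter : ∀ k, Measurable (X k)
  measurable_subgrad : ∀ k, Measurable (ξ k)
  measurable_pair : ∀ k, Measurable (pr k)
  init : ∀ ω, X 0 ω = X₀
  subgrad : ∀ k ω, ξ k ω ∈ clarkeSubdiff f (X k ω)
  uniform : ∀ k, μ.map (pr k) = uniformOn Set.univ
  indep : ∀ k, Indep (past X ξ pr k) (MeasurableSpace.comap (pr k) inferInstance) μ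
  step : ∀ k ω, IsStep C (γ k) (X k ω) (ξ k ω) (pr k ω) (X (k + 1) ω)

end Blocks

end RSSM

end

open RSSM

/-! Summed over all pairs of blocks, the block projections count an entry of `Xᵀξ` inside one block
ℓ-1 times and an entry across two blocks once. Writing Off for the part across blocks, the averaging
operator is therefore a combination of the identity and `ξ ↦ X Off(Xᵀξ)`. On the Stiefel manifold
the latter is an orthogonal projection, so the inverse is explicit, and the squared adaptive norm is
(ℓ/2) Q_X(u) with Q_X(u) = ‖u‖² + (ℓ-2)‖Off(Xᵀu)‖² (`inverse_avgOp`, `adaptiveNorm_sq`).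

The proximal objective is not convex along the manifold, but a short chord between two Stiefel
points can be pushed back to the manifold by its polar factor, at a cost of second order in the
chord length. Against the strong convexity ℓ/(2λ) of the quadratic term this loses τ + (2ℓ-1)L, and
what remains is quadratic growth at a minimizer (`blockObjective_growth`). Growth gives uniqueness
of the proximal point, hence its continuity by a closed graph argument, hence measurability and
integrability.

For the descent, the proximal point Y of the current iterate X is used as a competitor in the
envelope at the next iterate X'. A step is X' = X - γZ up to an error γ²‖Z‖²/2
(`IsStep.norm_sub_le`), where Z is the block projection of one full Riemannian subgradient ζ. Both
the displacement and the metric change; `blockQuad_step_le` bounds the change of Q by a part linear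
in Z and a part of order γ². Averaging the linear part over pairs turns the adaptive metric back
into the Euclidean pairing of ζ with Y - X, up to a quadratic error (`sum_linGain_le`). Weak
convexity bounds this pairing by f(Y) - f(X), and growth makes that difference negative of order Q
(`ProxSetting.avg_stepGain_le`). Conditioning on the past, of which the drawn pair is independent,
and then on the current iterate gives the estimate. -/

noncomputable section

namespace RSSM

/-! ### Frobenius inner product and matrices with orthonormal columns -/

section FrobeniusInner

variable {m ι κ : Type*} [Fintype m] [Fintype ι] [Fintype κ]

theorem frobInner_eq_sum (A B : Matrix m ι ℝ) : frobInner A B = ∑ i, ∑ j, A i j * B i j := by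
  simp only [frobInner, Matrix.trace, Matrix.diag, Matrix.mul_apply, Matrix.transpose_apply]
  exact Finset.sum_comm

theorem frobInner_comm (A B : Matrix m ι ℝ) : frobInner A B = frobInner B A := by
  simp only [frobInner_eq_sum, mul_comm]

theorem frobInner_add_left (A B C : Matrix m ι ℝ) :
    frobInner (A + B) C = frobInner A C + frobInner B C := by
  simp [frobInner, Matrix.add_mul]

theorem frobInner_add_right (A B C : Matrix m ι ℝ) :
    frobInner A (B + C) = frobInner A B + frobInner A C := by
  simp [frobInner, Matrix.mul_add]

theorem frobInner_smul_left (t : ℝ) (A B : Matrix m ι ℝ) :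
    frobInner (t • A) B = t * frobInner A B := by
  simp [frobInner]

theorem frobInner_smul_right (t : ℝ) (A B : Matrix m ι ℝ) :
    frobInner A (t • B) = t * frobInner A B := by
  simp [frobInner]

theorem frobInner_neg_left (A B : Matrix m ι ℝ) : frobInner (-A) B = -frobInner A B := by
  simp [frobInner]

theorem frobInner_neg_right (A B : Matrix m ι ℝ) : frobInner A (-B) = -frobInner A B := by
  simp [frobInner]

theorem frobInner_sub_left (A B C : Matrix m ι ℝ) :
    frobInner (A - B) C = frobInner A C - frobInner B C := by
  simp [frobInner, Matrix.sub_mul]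

theorem frobInner_sub_right (A B C : Matrix m ι ℝ) :
    frobInner A (B - C) = frobInner A B - frobInner A C := by
  simp [frobInner, Matrix.mul_sub]

theorem frobInner_sum_left {σ : Type*} (s : Finset σ) (F : σ → Matrix m ι ℝ) (B : Matrix m ι ℝ) :
    frobInner (∑ i ∈ s, F i) B = ∑ i ∈ s, frobInner (F i) B := by
  simp [frobInner, Matrix.transpose_sum, Matrix.sum_mul, Matrix.trace_sum]

theorem frobInner_transpose (A B : Matrix m ι ℝ) : frobInner Aᵀ Bᵀ = frobInner A B := by
  simp only [frobInner_eq_sum, Matrix.transpose_apply]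
  exact Finset.sum_comm

theorem frobInner_mul_left (A : Matrix m κ ℝ) (B : Matrix κ ι ℝ) (D : Matrix m ι ℝ) :
    frobInner (A * B) D = frobInner B (Aᵀ * D) := by
  simp [frobInner, Matrix.transpose_mul, Matrix.mul_assoc]

theorem frobInner_mul_right (A : Matrix m κ ℝ) (B : Matrix κ ι ℝ) (D : Matrix m ι ℝ) :
    frobInner (A * B) D = frobInner A (D * Bᵀ) := by
  rw [← frobInner_transpose, Matrix.transpose_mul, frobInner_mul_left, ← frobInner_transpose,
    Matrix.transpose_mul]
  simp

theorem frobInner_self (A : Matrix m ι ℝ) : frobInner A A = ‖A‖ ^ 2 := by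
  rw [frobInner_eq_sum, Matrix.frobenius_norm_def, ← Real.sqrt_eq_rpow, Real.sq_sqrt (by positivity)]
  simp [sq]

theorem norm_add_sq_frob (A B : Matrix m ι ℝ) :
    ‖A + B‖ ^ 2 = ‖A‖ ^ 2 + 2 * frobInner A B + ‖B‖ ^ 2 := by
  simp only [← frobInner_self, frobInner_add_left, frobInner_add_right, frobInner_comm B A]
  ring

theorem norm_sub_sq_frob (A B : Matrix m ι ℝ) :
    ‖A - B‖ ^ 2 = ‖A‖ ^ 2 - 2 * frobInner A B + ‖B‖ ^ 2 := by
  simp only [← frobInner_self, frobInner_sub_left, frobInner_sub_right, frobInner_comm B A]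
  ring

theorem frobInner_le (A B : Matrix m ι ℝ) : frobInner A B ≤ ‖A‖ * ‖B‖ := by
  have h1 := norm_add_sq_frob A B
  have h2 : ‖A + B‖ ^ 2 ≤ (‖A‖ + ‖B‖) ^ 2 := by gcongr; exact norm_add_le A B
  nlinarith

theorem abs_frobInner_le (A B : Matrix m ι ℝ) : |frobInner A B| ≤ ‖A‖ * ‖B‖ := by
  rw [abs_le]
  have h := frobInner_le (-A) B
  rw [frobInner_neg_left, norm_neg] at h
  exact ⟨by linarith, frobInner_le A B⟩

variable [DecidableEq ι]

theorem norm_mul_of_stiefel {X : Matrix m ι ℝ} (hX : Xᵀ * X = 1) (G : Matrix ι κ ℝ) :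
    ‖X * G‖ = ‖G‖ := by
  have h : ‖X * G‖ ^ 2 = ‖G‖ ^ 2 := by
    rw [← frobInner_self, frobInner_mul_left, ← Matrix.mul_assoc, hX, Matrix.one_mul, frobInner_self]
  exact (pow_left_inj₀ (norm_nonneg _) (norm_nonneg _) two_ne_zero).1 h

theorem norm_transpose_mul_le {X : Matrix m ι ℝ} (hX : Xᵀ * X = 1) (A : Matrix m κ ℝ) :
    ‖Xᵀ * A‖ ≤ ‖A‖ := by
  have h := norm_sub_sq_frob A (X * (Xᵀ * A))
  rw [frobInner_comm A, frobInner_mul_left, frobInner_self, norm_mul_of_stiefel hX] at h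
  have : ‖Xᵀ * A‖ ^ 2 ≤ ‖A‖ ^ 2 := by nlinarith [sq_nonneg ‖A - X * (Xᵀ * A)‖]
  exact (pow_le_pow_iff_left₀ (norm_nonneg _) (norm_nonneg _) two_ne_zero).1 this

theorem norm_transpose_mul_le' {X : Matrix m ι ℝ} (hX : Xᵀ * X = 1) (A : Matrix m κ ℝ) :
    ‖Aᵀ * X‖ ≤ ‖A‖ := by
  have := norm_transpose_mul_le hX A
  rwa [← Matrix.frobenius_norm_transpose, Matrix.transpose_mul, Matrix.transpose_transpose] at this

theorem norm_sq_of_stiefel {X : Matrix m ι ℝ} (hX : Xᵀ * X = 1) :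
    ‖X‖ ^ 2 = Fintype.card ι := by
  rw [← frobInner_self, frobInner, hX, Matrix.trace_one]

end FrobeniusInner

/-! ### The part of a square matrix across different blocks -/

section OffBlock

variable {ι β : Type*} [DecidableEq β]

/-- The off-diagonal blocks of `G` with respect to the partition of the indices by the values
of `c`. -/
def offBlock (c : ι → β) (G : Matrix ι ι ℝ) : Matrix ι ι ℝ :=
  Matrix.of fun a b => if c a = c b then 0 else G a b

variable (c : ι → β)

theorem offBlock_apply (G : Matrix ι ι ℝ) (a b : ι) :
    offBlock c G a b = if c a = c b then 0 else G a b := rfl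

theorem offBlock_add (G H : Matrix ι ι ℝ) :
    offBlock c (G + H) = offBlock c G + offBlock c H := by
  ext a b; by_cases h : c a = c b <;> simp [offBlock, h]

theorem offBlock_sub (G H : Matrix ι ι ℝ) :
    offBlock c (G - H) = offBlock c G - offBlock c H := by
  ext a b; by_cases h : c a = c b <;> simp [offBlock, h]

theorem offBlock_smul (t : ℝ) (G : Matrix ι ι ℝ) : offBlock c (t • G) = t • offBlock c G := by
  ext a b; by_cases h : c a = c b <;> simp [offBlock, h]

theorem offBlock_neg (G : Matrix ι ι ℝ) : offBlock c (-G) = -offBlock c G := by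
  ext a b; by_cases h : c a = c b <;> simp [offBlock, h]

theorem offBlock_one [DecidableEq ι] : offBlock c 1 = 0 := by
  ext a b
  by_cases h : c a = c b
  · simp [offBlock, h]
  · have : a ≠ b := fun e => h (by rw [e])
    simp [offBlock, h, this]

theorem offBlock_offBlock (G : Matrix ι ι ℝ) : offBlock c (offBlock c G) = offBlock c G := by
  ext a b; by_cases h : c a = c b <;> simp [offBlock, h]

theorem transpose_offBlock (G : Matrix ι ι ℝ) : (offBlock c G)ᵀ = offBlock c Gᵀ := by
  ext a b; by_cases h : c a = c b <;> simp [offBlock, h, eq_comm]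

theorem continuous_offBlock : Continuous (offBlock c) := by
  refine continuous_matrix fun a b => ?_
  by_cases h : c a = c b
  · simp only [offBlock_apply, h, if_true]; exact continuous_const
  · simp only [offBlock_apply, h, if_false]; exact continuous_id.matrix_elem a b

variable [Fintype ι]

theorem frobInner_offBlock_left (G H : Matrix ι ι ℝ) :
    frobInner (offBlock c G) H = frobInner G (offBlock c H) := by
  simp only [frobInner_eq_sum]
  refine Finset.sum_congr rfl fun a _ => Finset.sum_congr rfl fun b _ => ?_
  by_cases h : c a = c b <;> simp [offBlock, h]

theorem frobInner_offBlock (G H : Matrix ι ι ℝ) :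
    frobInner (offBlock c G) (offBlock c H) = frobInner (offBlock c G) H := by
  rw [← frobInner_offBlock_left, offBlock_offBlock]

theorem norm_offBlock_le (G : Matrix ι ι ℝ) : ‖offBlock c G‖ ≤ ‖G‖ := by
  have h := frobInner_le (offBlock c G) G
  rw [← frobInner_offBlock, frobInner_self] at h
  by_contra! hlt
  nlinarith [norm_nonneg G]

end OffBlock

/-! ### Counting pairs of blocks -/

section Counting

variable {ℓ : ℕ}

theorem card_blockPair : Fintype.card (BlockPair ℓ) = ℓ.choose 2 := by
  simp [BlockPair, Fintype.card_finset_len]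

theorem sum_blockPair_mem_mem_of_ne {i j : Fin ℓ} (h : i ≠ j) :
    (∑ s : BlockPair ℓ, if i ∈ s.1 ∧ j ∈ s.1 then (1 : ℝ) else 0) = 1 := by
  rw [Finset.sum_eq_single (⟨{i, j}, Finset.card_pair h⟩ : BlockPair ℓ)]
  · simp
  · intro s _ hs
    rw [if_neg]
    rintro ⟨hi, hj⟩
    refine hs (Subtype.ext (Finset.eq_of_subset_of_card_le ?_ ?_).symm)
    · intro x hx
      rcases Finset.mem_insert.1 hx with rfl | hx
      · exact hi
      · rw [Finset.mem_singleton.1 hx]; exact hj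
    · rw [s.2, Finset.card_pair h]
  · simp

/-- Double counting: a pair containing `i` has exactly one other member, and each of the ℓ-1 other
indices occurs in exactly one such pair. -/
theorem sum_blockPair_mem (i : Fin ℓ) :
    (∑ s : BlockPair ℓ, if i ∈ s.1 then (1 : ℝ) else 0) = ℓ - 1 := by
  have h1 : ∀ s : BlockPair ℓ, (if i ∈ s.1 then (1 : ℝ) else 0) =
      ∑ j ∈ Finset.univ.erase i, if i ∈ s.1 ∧ j ∈ s.1 then (1 : ℝ) else 0 := by
    intro s
    by_cases hi : i ∈ s.1
    · have h2 : (Finset.univ.erase i).filter (fun j => j ∈ s.1) = s.1.erase i := by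
        ext j; simp
      have h3 : (s.1.erase i).card = 1 := by rw [Finset.card_erase_of_mem hi, s.2]
      simp only [hi, true_and, if_true, Finset.sum_boole, h2, h3, Nat.cast_one]
    · simp [hi]
  simp only [h1]
  rw [Finset.sum_comm, Finset.sum_congr rfl (g := fun _ => (1 : ℝ))]
  · have : 1 ≤ ℓ := Nat.one_le_of_lt i.2
    simp [Finset.card_erase_of_mem, Nat.cast_sub this]
  · intro j hj
    exact sum_blockPair_mem_mem_of_ne (Finset.ne_of_mem_erase hj).symm

theorem sum_blockPair_mem_mem (i j : Fin ℓ) :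
    (∑ s : BlockPair ℓ, if i ∈ s.1 ∧ j ∈ s.1 then (1 : ℝ) else 0) =
      if i = j then (ℓ : ℝ) - 1 else 1 := by
  split_ifs with h
  · subst h; simp only [and_self]; exact sum_blockPair_mem i
  · exact sum_blockPair_mem_mem_of_ne h

end Counting

/-! ### Column masks -/

section Indicator

variable {m ι : Type*} [Fintype ι] [DecidableEq ι]

/-- The diagonal matrix that keeps the columns with index in `S`. -/
def colMask (S : Finset ι) : Matrix ι ι ℝ := Matrix.diagonal fun a => if a ∈ S then 1 else 0

theorem mul_colMask_apply (A : Matrix m ι ℝ) (S : Finset ι) (i : m) (a : ι) :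
    (A * colMask S) i a = if a ∈ S then A i a else 0 := by
  simp [colMask, Matrix.mul_diagonal]

theorem colMask_mul_apply (A : Matrix ι m ℝ) (S : Finset ι) (i : m) (a : ι) :
    (colMask S * A) a i = if a ∈ S then A a i else 0 := by
  simp [colMask, Matrix.diagonal_mul]

theorem colMask_mul_self (S : Finset ι) : colMask S * colMask S = colMask S := by
  ext a b
  simp only [mul_colMask_apply]
  split_ifs with h
  · rfl
  · simp only [colMask, Matrix.diagonal_apply]
    split_ifs with h1 h2
    · subst h1; exact absurd h2 h
    · rfl
    · rfl

theorem colMask_compl (S : Finset ι) : colMask Sᶜ = 1 - colMask S := by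
  ext a b
  by_cases h : a = b
  · subst h; by_cases h' : a ∈ S <;> simp [colMask, h']
  · simp [colMask, h]

theorem cols_mul_transpose_cols {m' : Type*} (A : Matrix m ι ℝ) (B : Matrix m' ι ℝ)
    (S : Finset ι) : cols A S * (cols B S)ᵀ = A * colMask S * Bᵀ := by
  ext i j
  rw [Matrix.mul_apply, Matrix.mul_apply]
  simp only [mul_colMask_apply, Matrix.transpose_apply]
  refine (Finset.sum_coe_sort S fun a => A i a * B j a).trans ?_
  simp [Finset.sum_ite_mem, ite_mul]

end Indicator

/-! ### The averaging operator, its inverse and the adaptive norm -/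

section AvgOp

variable {n p ℓ : ℕ}

theorem IsPartition.exists_index {C : Fin ℓ → Finset (Fin p)} (hC : IsPartition C) :
    ∃ c : Fin p → Fin ℓ, ∀ i a, a ∈ C i ↔ c a = i := by
  choose c hc using hC.2
  refine ⟨c, fun i a => ⟨fun h => ?_, fun h => h ▸ hc a⟩⟩
  by_contra hne
  exact Finset.disjoint_left.1 (hC.1 _ _ hne) (hc a) h

variable {C : Fin ℓ → Finset (Fin p)} {c : Fin p → Fin ℓ}

theorem mem_pairCols (hc : ∀ i a, a ∈ C i ↔ c a = i) (s : BlockPair ℓ) (a : Fin p) :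
    a ∈ pairCols C s ↔ c a ∈ s.1 := by
  simp [pairCols, hc]

/-- With J the mask of `S`, the frozen columns contribute X(1 - J)Xᵀ. The form chosen separates a
column mask from a two-sided mask of `Xᵀξ`, so that sums over pairs become entry counts. -/
theorem blockOp_apply_eq (X ξ : Matrix (Fin n) (Fin p) ℝ) (S : Finset (Fin p)) :
    blockOp X S ξ = (ξ - X * (Xᵀ * ξ)) * colMask S + X * (colMask S * (Xᵀ * ξ) * colMask S) := by
  have h : blockOp X S ξ =
    (1 - cols X Sᶜ * (cols X Sᶜ)ᵀ) * cols ξ S * (cols (1 : Matrix (Fin p) (Fin p) ℝ) S)ᵀ := rfl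
  rw [h, Matrix.mul_assoc, cols_mul_transpose_cols, cols_mul_transpose_cols, colMask_compl,
    Matrix.transpose_one, Matrix.mul_one]
  simp only [Matrix.mul_sub, Matrix.sub_mul, Matrix.mul_one, Matrix.one_mul, Matrix.mul_assoc]
  abel

theorem sum_colMask (hc : ∀ i a, a ∈ C i ↔ c a = i) :
    ∑ s : BlockPair ℓ, colMask (pairCols C s) = ((ℓ : ℝ) - 1) • (1 : Matrix (Fin p) (Fin p) ℝ) := by
  ext a b
  by_cases h : a = b
  · subst h
    have := sum_blockPair_mem (c a)
    simpa [Matrix.sum_apply, colMask, mem_pairCols hc] using this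
  · simp [Matrix.sum_apply, colMask, h]

/-- An entry inside a block survives in ℓ-1 pairs, an entry across two blocks in exactly one, and
(ℓ-1) - (ℓ-2) = 1. -/
theorem sum_colMask_mul_mul (hc : ∀ i a, a ∈ C i ↔ c a = i) (G : Matrix (Fin p) (Fin p) ℝ) :
    ∑ s : BlockPair ℓ, colMask (pairCols C s) * G * colMask (pairCols C s) =
      ((ℓ : ℝ) - 1) • G - ((ℓ : ℝ) - 2) • offBlock c G := by
  ext a b
  have h : ∀ s : BlockPair ℓ, (colMask (pairCols C s) * G * colMask (pairCols C s)) a b =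
      (if c a ∈ s.1 ∧ c b ∈ s.1 then 1 else 0) * G a b := by
    intro s
    rw [mul_colMask_apply, colMask_mul_apply]
    simp only [mem_pairCols hc]
    by_cases h1 : c a ∈ s.1 <;> by_cases h2 : c b ∈ s.1 <;> simp [h1, h2]
  rw [Matrix.sum_apply, Finset.sum_congr rfl fun s _ => h s, ← Finset.sum_mul,
    sum_blockPair_mem_mem]
  by_cases hab : c a = c b
  · simp [offBlock_apply, hab]
  · simp [offBlock_apply, hab]; ring

theorem sum_blockOp (hc : ∀ i a, a ∈ C i ↔ c a = i) (X ξ : Matrix (Fin n) (Fin p) ℝ) :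
    ∑ s : BlockPair ℓ, blockOp X (pairCols C s) ξ =
      ((ℓ : ℝ) - 1) • ξ - ((ℓ : ℝ) - 2) • (X * offBlock c (Xᵀ * ξ)) := by
  simp only [blockOp_apply_eq, Finset.sum_add_distrib, ← Matrix.mul_sum, sum_colMask hc,
    sum_colMask_mul_mul hc, Matrix.mul_smul, Matrix.mul_one, Matrix.mul_sub, smul_sub]
  abel

theorem cast_choose_two (ℓ : ℕ) : ((ℓ.choose 2 : ℕ) : ℝ) = ℓ * (ℓ - 1) / 2 :=
  Nat.cast_choose_two ℝ ℓ

theorem avgOp_apply (hc : ∀ i a, a ∈ C i ↔ c a = i) (hℓ : 2 ≤ ℓ)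
    (X ξ : Matrix (Fin n) (Fin p) ℝ) :
    avgOp C X ξ =
      (2 / (ℓ : ℝ)) • (ξ - (((ℓ : ℝ) - 2) / (ℓ - 1)) • (X * offBlock c (Xᵀ * ξ))) := by
  have h2 : (2 : ℝ) ≤ ℓ := by exact_mod_cast hℓ
  have h1 : (ℓ : ℝ) - 1 ≠ 0 := by linarith
  have h0 : (ℓ : ℝ) ≠ 0 := by linarith
  simp only [avgOp, LinearMap.smul_apply, LinearMap.sum_apply, sum_blockOp hc, cast_choose_two,
    smul_sub, smul_smul]
  congr 2 <;> field_simp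

/-- The inverse of the averaging operator at a point of the Stiefel manifold. -/
def avgInv (c : Fin p → Fin ℓ) (X : Matrix (Fin n) (Fin p) ℝ) :
    Module.End ℝ (Matrix (Fin n) (Fin p) ℝ) where
  toFun ξ := ((ℓ : ℝ) / 2) • (ξ + ((ℓ : ℝ) - 2) • (X * offBlock c (Xᵀ * ξ)))
  map_add' ξ η := by
    simp only [Matrix.mul_add, offBlock_add, smul_add]; abel
  map_smul' t ξ := by
    simp only [Matrix.mul_smul, offBlock_smul, RingHom.id_apply, smul_add,
      smul_comm _ t]

theorem avgInv_apply (c : Fin p → Fin ℓ) (X ξ : Matrix (Fin n) (Fin p) ℝ) :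
    avgInv c X ξ = ((ℓ : ℝ) / 2) • (ξ + ((ℓ : ℝ) - 2) • (X * offBlock c (Xᵀ * ξ))) := rfl

/-- Since `Xᵀ * X = 1`, the map `ξ ↦ X Off(Xᵀξ)` is idempotent. On its range the averaging operator
is (2/ℓ)/(ℓ-1), on its kernel 2/ℓ; inverting the two factors gives `avgInv`. -/
theorem inverse_avgOp (hc : ∀ i a, a ∈ C i ↔ c a = i) (hℓ : 2 ≤ ℓ)
    {X : Matrix (Fin n) (Fin p) ℝ} (hX : Xᵀ * X = 1) :
    Ring.inverse (avgOp C X) = avgInv c X := by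
  have h2 : (2 : ℝ) ≤ ℓ := by exact_mod_cast hℓ
  have h1 : (ℓ : ℝ) - 1 ≠ 0 := by linarith
  have h0 : (ℓ : ℝ) ≠ 0 := by linarith
  have hT : ∀ ξ : Matrix (Fin n) (Fin p) ℝ,
      Xᵀ * (X * offBlock c (Xᵀ * ξ)) = offBlock c (Xᵀ * ξ) := fun ξ => by
    rw [← Matrix.mul_assoc, hX, Matrix.one_mul]
  have hl : avgInv c X * avgOp C X = 1 := by
    ext1 ξ
    rw [Module.End.mul_apply, Module.End.one_apply, avgInv_apply, avgOp_apply hc hℓ]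
    simp only [Matrix.mul_smul, Matrix.mul_sub, offBlock_smul, offBlock_sub, hT, offBlock_offBlock,
      smul_sub, smul_add, smul_smul]
    match_scalars
    all_goals field_simp
    all_goals ring
  have hr : avgOp C X * avgInv c X = 1 := by
    ext1 ξ
    rw [Module.End.mul_apply, Module.End.one_apply, avgInv_apply, avgOp_apply hc hℓ]
    simp only [Matrix.mul_smul, Matrix.mul_add, offBlock_smul, offBlock_add, hT, offBlock_offBlock,
      smul_sub, smul_add, smul_smul]
    match_scalars
    all_goals field_simp
    all_goals ring
  -- `Ring.inverse` is zero at non-units, so both one-sided identities are needed to exhibit a unit.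
  exact Ring.inverse_unit (⟨avgOp C X, avgInv c X, hr, hl⟩ : (Module.End ℝ _)ˣ)

/-- The quadratic form `‖u‖² + (ℓ - 2) ‖Off (Xᵀ u)‖²`, which is `2 / ℓ` times the square of the
adaptive norm at `X`. -/
def blockQuad (c : Fin p → Fin ℓ) (X u : Matrix (Fin n) (Fin p) ℝ) : ℝ :=
  ‖u‖ ^ 2 + ((ℓ : ℝ) - 2) * ‖offBlock c (Xᵀ * u)‖ ^ 2

theorem norm_sq_le_blockQuad (hℓ : 2 ≤ ℓ) (c : Fin p → Fin ℓ) (X u : Matrix (Fin n) (Fin p) ℝ) :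
    ‖u‖ ^ 2 ≤ blockQuad c X u := by
  have h2 : (2 : ℝ) ≤ ℓ := by exact_mod_cast hℓ
  have := mul_nonneg (sub_nonneg.2 h2) (sq_nonneg ‖offBlock c (Xᵀ * u)‖)
  rw [blockQuad]; linarith

theorem adaptiveNorm_sq (hc : ∀ i a, a ∈ C i ↔ c a = i) (hℓ : 2 ≤ ℓ)
    {X : Matrix (Fin n) (Fin p) ℝ} (hX : Xᵀ * X = 1) (u : Matrix (Fin n) (Fin p) ℝ) :
    adaptiveNorm C X u ^ 2 = (ℓ : ℝ) / 2 * blockQuad c X u := by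
  have h : frobInner (avgInv c X u) u = (ℓ : ℝ) / 2 * blockQuad c X u := by
    rw [avgInv_apply, frobInner_smul_left, frobInner_add_left, frobInner_smul_left,
      frobInner_mul_left, ← frobInner_offBlock, frobInner_self, frobInner_self, blockQuad]
  rw [adaptiveNorm, mahalNorm, inverse_avgOp hc hℓ hX, Real.sq_sqrt, h]
  rw [h]
  exact mul_nonneg (by positivity) ((sq_nonneg ‖u‖).trans (norm_sq_le_blockQuad hℓ c X u))

theorem proxObjective_eq (hc : ∀ i a, a ∈ C i ↔ c a = i) (hℓ : 2 ≤ ℓ)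
    {X : Matrix (Fin n) (Fin p) ℝ} (hX : Xᵀ * X = 1) (f : Matrix (Fin n) (Fin p) ℝ → ℝ) (lam : ℝ)
    (Y : Matrix (Fin n) (Fin p) ℝ) :
    proxObjective C f lam X Y = f Y + ℓ / (4 * lam) * blockQuad c X (Y - X) := by
  rw [proxObjective, adaptiveNorm_sq hc hℓ hX]
  ring

end AvgOp

/-! ### Polar factors -/

section Polar

variable {m ι κ : Type*} [Fintype m] [Fintype ι] [Fintype κ] [DecidableEq ι]

theorem exists_orthogonal_diagonalization {G : Matrix ι ι ℝ} (hG : Gᵀ = G) :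
    ∃ (V : Matrix ι ι ℝ) (d : ι → ℝ), Vᵀ * V = 1 ∧ V * Vᵀ = 1 ∧ Vᵀ * G * V = Matrix.diagonal d := by
  have hA : G.IsHermitian := by
    rw [Matrix.IsHermitian, Matrix.conjTranspose_eq_transpose_of_trivial, hG]
  have hst : star (hA.eigenvectorUnitary : Matrix ι ι ℝ) =
      (hA.eigenvectorUnitary : Matrix ι ι ℝ)ᵀ := by
    rw [Matrix.star_eq_conjTranspose, Matrix.conjTranspose_eq_transpose_of_trivial]
  have h1 : (hA.eigenvectorUnitary : Matrix ι ι ℝ)ᵀ * (hA.eigenvectorUnitary : Matrix ι ι ℝ) = 1 := by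
    rw [← hst]; exact Unitary.coe_star_mul_self _
  have h2 : (hA.eigenvectorUnitary : Matrix ι ι ℝ) * (hA.eigenvectorUnitary : Matrix ι ι ℝ)ᵀ = 1 := by
    rw [← hst]; exact Unitary.coe_mul_star_self _
  refine ⟨hA.eigenvectorUnitary, hA.eigenvalues, h1, h2, ?_⟩
  have h3 := hA.spectral_theorem
  rw [Unitary.conjStarAlgAut_apply, hst] at h3
  generalize (hA.eigenvectorUnitary : Matrix ι ι ℝ) = V at *
  refine (congrArg (fun A => Vᵀ * A * V) h3).trans ?_
  calc Vᵀ * (V * Matrix.diagonal (RCLike.ofReal ∘ hA.eigenvalues) * Vᵀ) * V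
      = (Vᵀ * V) * Matrix.diagonal (RCLike.ofReal ∘ hA.eigenvalues) * (Vᵀ * V) := by
        simp only [Matrix.mul_assoc]
    _ = _ := by rw [h1]; simp

theorem norm_mul_of_orthogonal {V : Matrix ι ι ℝ} (hV : V * Vᵀ = 1) (A : Matrix m ι ℝ) :
    ‖A * V‖ = ‖A‖ := by
  rw [← Matrix.frobenius_norm_transpose, Matrix.transpose_mul,
    norm_mul_of_stiefel (X := Vᵀ) (by simpa using hV), Matrix.frobenius_norm_transpose]

/-- A matrix with a lower bound `r` on its singular values is close to a matrix with orthonormal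
columns and the same column space (its polar factor). -/
theorem exists_polar_factor {W : Matrix m ι ℝ} {r : ℝ} (hr : 0 < r)
    (h : ∀ x : Matrix ι Unit ℝ, r ^ 2 * ‖x‖ ^ 2 ≤ ‖W * x‖ ^ 2) :
    ∃ B : Matrix ι ι ℝ, (W * B)ᵀ * (W * B) = 1 ∧ (1 + r) * ‖W - W * B‖ ≤ ‖Wᵀ * W - 1‖ := by
  obtain ⟨V, d, hV, hV', hG⟩ :=
    exists_orthogonal_diagonalization (G := Wᵀ * W) (by simp [Matrix.transpose_mul])
  have hM : (W * V)ᵀ * (W * V) = Matrix.diagonal d := by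
    rw [← hG]; simp only [Matrix.transpose_mul, Matrix.mul_assoc]
  -- The hypothesis is tested on the eigenvectors of `Wᵀ * W`, the columns of `V`.
  have hd : ∀ i, r ^ 2 ≤ d i := by
    intro i
    have h1 := h (V * (Matrix.of fun j _ => if j = i then 1 else 0 : Matrix ι Unit ℝ))
    have h2 : ‖(Matrix.of fun j _ => if j = i then (1 : ℝ) else 0 : Matrix ι Unit ℝ)‖ ^ 2 = 1 := by
      rw [← frobInner_self, frobInner_eq_sum]; simp
    rw [norm_mul_of_stiefel hV, h2, ← Matrix.mul_assoc, ← frobInner_self, frobInner_mul_left,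
      ← Matrix.mul_assoc, hM, frobInner_eq_sum] at h1
    simpa [Matrix.diagonal_mul] using h1
  have hs : ∀ i, r ≤ √(d i) := fun i => Real.le_sqrt_of_sq_le (hd i)
  have hdd : ∀ i, d i = √(d i) * √(d i) := fun i =>
    (Real.mul_self_sqrt ((sq_nonneg r).trans (hd i))).symm
  have hs0 : ∀ i, √(d i) ≠ 0 := fun i => (hr.trans_le (hs i)).ne'
  set E : Matrix ι ι ℝ := Matrix.diagonal fun i => (√(d i))⁻¹ with hE
  have hEt : Eᵀ = E := by simp [hE]
  -- The witness is the inverse square root of `Wᵀ * W`.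
  refine ⟨V * E * Vᵀ, ?_, ?_⟩
  · calc (W * (V * E * Vᵀ))ᵀ * (W * (V * E * Vᵀ))
        = V * (E * ((W * V)ᵀ * (W * V)) * E) * Vᵀ := by
          simp only [Matrix.transpose_mul, Matrix.transpose_transpose, hEt, Matrix.mul_assoc]
      _ = V * 1 * Vᵀ := by
          rw [hM, hE, Matrix.diagonal_mul_diagonal, Matrix.diagonal_mul_diagonal]
          congr 2
          rw [← Matrix.diagonal_one]
          congr 1
          funext i
          conv_lhs => rw [hdd i]
          simp only [Real.sqrt_mul_self (Real.sqrt_nonneg _)]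
          field_simp [hs0 i]
      _ = 1 := by rw [Matrix.mul_one, hV']
  · have h1 : ‖W - W * (V * E * Vᵀ)‖ ^ 2 = ∑ i, (√(d i) - 1) ^ 2 := by
      have h2 : (W - W * (V * E * Vᵀ)) * V = W * V * (1 - E) := by
        calc (W - W * (V * E * Vᵀ)) * V = W * V - W * V * E * (Vᵀ * V) := by
              simp only [Matrix.sub_mul, Matrix.mul_assoc]
          _ = W * V * (1 - E) := by rw [hV, Matrix.mul_one, Matrix.mul_sub, Matrix.mul_one]
      have h3 : (1 - E : Matrix ι ι ℝ) = Matrix.diagonal fun i => 1 - (√(d i))⁻¹ := by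
        rw [hE, ← Matrix.diagonal_one, Matrix.diagonal_sub]
      rw [← norm_mul_of_orthogonal hV' (W - W * (V * E * Vᵀ)), h2, ← frobInner_self,
        frobInner_mul_left, ← Matrix.mul_assoc, hM, h3, Matrix.diagonal_mul_diagonal, frobInner,
        Matrix.diagonal_transpose, Matrix.diagonal_mul_diagonal, Matrix.trace_diagonal]
      refine Finset.sum_congr rfl fun i _ => ?_
      conv_lhs => rw [hdd i]
      simp only [Real.sqrt_mul_self (Real.sqrt_nonneg _)]
      field_simp [hs0 i]
    have h4 : ‖Wᵀ * W - 1‖ ^ 2 = ∑ i, (d i - 1) ^ 2 := by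
      have h5 : Vᵀ * ((Wᵀ * W - 1) * V) = Matrix.diagonal fun i => d i - 1 := by
        rw [Matrix.sub_mul, Matrix.mul_sub, ← Matrix.mul_assoc, hG, Matrix.one_mul, hV,
          ← Matrix.diagonal_one, Matrix.diagonal_sub]
      rw [← norm_mul_of_orthogonal hV' (Wᵀ * W - 1),
        ← norm_mul_of_stiefel (X := Vᵀ) (by simpa using hV') ((Wᵀ * W - 1) * V), h5,
        ← frobInner_self, frobInner, Matrix.diagonal_transpose, Matrix.diagonal_mul_diagonal,
        Matrix.trace_diagonal]
      exact Finset.sum_congr rfl fun i _ => (sq _).symm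
    refine (pow_le_pow_iff_left₀ (by positivity) (norm_nonneg _) two_ne_zero).1 ?_
    rw [mul_pow, h1, h4, Finset.mul_sum]
    refine Finset.sum_le_sum fun i _ => ?_
    -- With σ = √d this is σ² - 1 = (σ + 1)(σ - 1), and σ ≥ r produces the factor 1 + r.
    have h6 : (d i - 1) ^ 2 = (√(d i) + 1) ^ 2 * (√(d i) - 1) ^ 2 := by
      conv_lhs => rw [hdd i]
      ring
    rw [h6]
    gcongr ?_ ^ 2 * _
    linarith [hs i]

end Polar

/-! ### Column selection as multiplication by columns of the identity -/

section Columns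

variable {m ι : Type*} [Fintype ι] [DecidableEq ι]

/-- The columns of the identity matrix with index in `S`. -/
def colIncl (S : Finset ι) : Matrix ι S ℝ := cols (1 : Matrix ι ι ℝ) S

theorem cols_eq_mul (A : Matrix m ι ℝ) (S : Finset ι) :
    cols A S = A * colIncl S := by
  ext i j
  change A i j = _
  rw [Matrix.mul_apply]
  simp [colIncl, cols, Matrix.one_apply]

theorem cols_one_mul_transpose (S : Finset ι) :
    colIncl S * (colIncl S)ᵀ = colMask S := by
  rw [colIncl, cols_mul_transpose_cols, Matrix.transpose_one, Matrix.one_mul, Matrix.mul_one]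

theorem transpose_cols_one_mul (S : Finset ι) :
    (colIncl S)ᵀ * colIncl S = 1 := by
  rw [← cols_eq_mul]
  ext a b
  change (1 : Matrix ι ι ℝ) b a = _
  rw [Matrix.one_apply, Matrix.one_apply]
  exact if_congr (by rw [Subtype.ext_iff, eq_comm]) rfl rfl

theorem colMask_mul_cols_one (S : Finset ι) :
    colMask S * colIncl S = colIncl S := by
  rw [← cols_one_mul_transpose, Matrix.mul_assoc, transpose_cols_one_mul, Matrix.mul_one]

theorem transpose_colMask (S : Finset ι) : (colMask S)ᵀ = colMask S := by
  rw [← cols_one_mul_transpose, Matrix.transpose_mul, Matrix.transpose_transpose]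

theorem colMask_mul_cols_one_compl (S : Finset ι) :
    colMask S * colIncl Sᶜ = 0 := by
  have h := colMask_mul_cols_one Sᶜ
  rw [colMask_compl, Matrix.sub_mul, Matrix.one_mul, sub_eq_self] at h
  exact h

theorem transpose_cols_one_compl_mul_colMask (S : Finset ι) :
    (colIncl Sᶜ)ᵀ * colMask S = 0 := by
  have := congrArg Matrix.transpose (colMask_mul_cols_one_compl S)
  rwa [Matrix.transpose_mul, transpose_colMask, Matrix.transpose_zero] at this

theorem transpose_cols_one_compl_mul (S : Finset ι) :
    (colIncl Sᶜ)ᵀ * colIncl S = 0 := by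
  rw [← colMask_mul_cols_one S, ← Matrix.mul_assoc, transpose_cols_one_compl_mul_colMask,
    Matrix.zero_mul]

end Columns

/-! ### Tangent projection on the Stiefel manifold -/

section TangentPart

variable {m ι : Type*} [Fintype m] [Fintype ι]

/-- The orthogonal projection of `ξ` onto the tangent space of the Stiefel manifold at `X`. -/
def tangentPart (X ξ : Matrix m ι ℝ) : Matrix m ι ℝ :=
  ξ - X * ((1 / 2 : ℝ) • (Xᵀ * ξ + ξᵀ * X))

variable [DecidableEq ι] {X : Matrix m ι ℝ}

theorem transpose_mul_tangentPart (hX : Xᵀ * X = 1) (ξ : Matrix m ι ℝ) :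
    Xᵀ * tangentPart X ξ = (1 / 2 : ℝ) • (Xᵀ * ξ - ξᵀ * X) := by
  rw [tangentPart, Matrix.mul_sub, ← Matrix.mul_assoc, hX, Matrix.one_mul]
  module

theorem transpose_mul_tangentPart_antisymm (hX : Xᵀ * X = 1) (ξ : Matrix m ι ℝ) :
    (Xᵀ * tangentPart X ξ)ᵀ = -(Xᵀ * tangentPart X ξ) := by
  rw [transpose_mul_tangentPart hX]
  simp only [Matrix.transpose_smul, Matrix.transpose_sub, Matrix.transpose_mul,
    Matrix.transpose_transpose]
  module

/-- The removed part `X * H`, with `H` the symmetric part of `Xᵀ * ξ`, satisfies ⟨ξ, XH⟩ = ‖H‖² =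
‖XH‖², so Pythagoras applies. -/
theorem norm_tangentPart_le (hX : Xᵀ * X = 1) (ξ : Matrix m ι ℝ) : ‖tangentPart X ξ‖ ≤ ‖ξ‖ := by
  set H : Matrix ι ι ℝ := (1 / 2 : ℝ) • (Xᵀ * ξ + ξᵀ * X) with hH
  have hHt : Hᵀ = H := by
    simp only [hH, Matrix.transpose_smul, Matrix.transpose_add, Matrix.transpose_mul,
      Matrix.transpose_transpose, add_comm]
  have h2 : frobInner ξ (X * H) = ‖H‖ ^ 2 := by
    have h3 : frobInner (ξᵀ * X) H = frobInner (Xᵀ * ξ) H := by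
      rw [← frobInner_transpose, hHt]; simp [Matrix.transpose_mul]
    have h4 : frobInner ξ (X * H) = frobInner (Xᵀ * ξ) H := by
      rw [frobInner_comm, frobInner_mul_left, frobInner_comm]
    have h5 : frobInner H H = (1 / 2) * (frobInner (Xᵀ * ξ) H + frobInner (ξᵀ * X) H) := by
      rw [hH, frobInner_smul_left, frobInner_add_left]
    rw [← frobInner_self, h5, h3, h4]; ring
  have h1 : ‖tangentPart X ξ‖ ^ 2 = ‖ξ‖ ^ 2 - ‖H‖ ^ 2 := by
    rw [tangentPart, ← hH, norm_sub_sq_frob, h2, norm_mul_of_stiefel hX]; ring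
  refine (pow_le_pow_iff_left₀ (norm_nonneg _) (norm_nonneg _) two_ne_zero).1 ?_
  nlinarith [sq_nonneg ‖H‖]

end TangentPart

/-! ### One step: block projection, feasibility and second-order error -/

section Step

variable {n p ℓ : ℕ} {C : Fin ℓ → Finset (Fin p)} {X ξ X' : Matrix (Fin n) (Fin p) ℝ} {γ : ℝ}
  {s : BlockPair ℓ}

theorem transpose_mul_blockOp (hX : Xᵀ * X = 1) (ξ : Matrix (Fin n) (Fin p) ℝ)
    (S : Finset (Fin p)) :
    Xᵀ * blockOp X S ξ = colMask S * (Xᵀ * ξ) * colMask S := by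
  rw [blockOp_apply_eq, Matrix.mul_add, ← Matrix.mul_assoc Xᵀ X, hX, Matrix.one_mul,
    ← Matrix.mul_assoc Xᵀ (ξ - _), Matrix.mul_sub, ← Matrix.mul_assoc Xᵀ X, hX, Matrix.one_mul]
  simp

theorem blockOp_mul_colMask (X ξ : Matrix (Fin n) (Fin p) ℝ) (S : Finset (Fin p)) :
    blockOp X S ξ * colMask S = blockOp X S ξ := by
  simp only [blockOp_apply_eq, Matrix.add_mul, Matrix.mul_assoc, colMask_mul_self]

/-- At a Stiefel point the block operator is an orthogonal projection. This makes the sum of the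
squared norms over pairs a single inner product with the summed operator. -/
theorem norm_sq_blockOp (hX : Xᵀ * X = 1) (ξ : Matrix (Fin n) (Fin p) ℝ) (S : Finset (Fin p)) :
    ‖blockOp X S ξ‖ ^ 2 = frobInner (blockOp X S ξ) ξ := by
  have h1 : Xᵀ * (ξ - X * (Xᵀ * ξ)) = 0 := by
    rw [Matrix.mul_sub, ← Matrix.mul_assoc, hX, Matrix.one_mul, sub_self]
  have h2 : frobInner (blockOp X S ξ) (X * (Xᵀ * ξ)) =
      frobInner (colMask S * (Xᵀ * ξ) * colMask S) (Xᵀ * ξ) := by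
    rw [frobInner_comm, frobInner_mul_left, transpose_mul_blockOp hX, frobInner_comm]
  have h3 : frobInner (blockOp X S ξ) (ξ - X * (Xᵀ * ξ)) =
      frobInner ((ξ - X * (Xᵀ * ξ)) * colMask S) (ξ - X * (Xᵀ * ξ)) := by
    rw [blockOp_apply_eq, frobInner_add_left, frobInner_mul_left X, h1]
    simp [frobInner]
  have h4 : frobInner (blockOp X S ξ) (blockOp X S ξ) =
      frobInner (blockOp X S ξ) ((ξ - X * (Xᵀ * ξ)) * colMask S) +
        frobInner (blockOp X S ξ) (X * (colMask S * (Xᵀ * ξ) * colMask S)) := by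
    rw [← frobInner_add_right, ← blockOp_apply_eq]
  have h5 : frobInner (blockOp X S ξ) ((ξ - X * (Xᵀ * ξ)) * colMask S) =
      frobInner (blockOp X S ξ) (ξ - X * (Xᵀ * ξ)) := by
    rw [frobInner_comm, frobInner_mul_right, transpose_colMask, blockOp_mul_colMask,
      frobInner_comm]
  have h6 : frobInner (blockOp X S ξ) (X * (colMask S * (Xᵀ * ξ) * colMask S)) =
      frobInner (blockOp X S ξ) (X * (Xᵀ * ξ)) := by
    rw [h2, frobInner_comm, frobInner_mul_left, transpose_mul_blockOp hX, frobInner_mul_right,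
      Matrix.mul_assoc (colMask S), frobInner_mul_left, transpose_colMask,
      frobInner_comm]
    simp only [Matrix.mul_assoc, colMask_mul_self]
    simp only [← Matrix.mul_assoc (colMask S) (colMask S), colMask_mul_self]
  rw [← frobInner_self, h4, h5, h6, ← frobInner_add_right]
  congr 1
  abel

theorem blockTangent_eq (X : Matrix (Fin n) (Fin p) ℝ) (S : Finset (Fin p)) {ζ}
    (hζ : ζ ∈ blockTangent X S) :
    ζᵀ * (X * colIncl S) + (X * colIncl S)ᵀ * ζ = 0 ∧ (X * colIncl Sᶜ)ᵀ * ζ = 0 := by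
  obtain ⟨h1, h2⟩ := hζ
  rw [cols_eq_mul X S] at h1
  rw [cols_eq_mul X Sᶜ] at h2
  exact ⟨h1, h2⟩

theorem cols_blockOp_mem_blockTangent (hX : Xᵀ * X = 1) (ξ : Matrix (Fin n) (Fin p) ℝ)
    (S : Finset (Fin p)) : cols (blockOp X S (tangentPart X ξ)) S ∈ blockTangent X S := by
  have hK := transpose_mul_tangentPart_antisymm hX ξ
  have hZ := transpose_mul_blockOp hX (tangentPart X ξ) S
  set Z := blockOp X S (tangentPart X ξ)
  set K := Xᵀ * tangentPart X ξ
  have hZt : Zᵀ * X = -(Xᵀ * Z) := by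
    have : Zᵀ * X = (Xᵀ * Z)ᵀ := by simp
    rw [this, hZ]
    simp [Matrix.transpose_mul, transpose_colMask, hK, Matrix.mul_assoc]
  refine ⟨?_, ?_⟩
  · rw [cols_eq_mul X, cols_eq_mul Z, Matrix.transpose_mul, Matrix.transpose_mul]
    calc _ = (colIncl S)ᵀ * (Zᵀ * X + Xᵀ * Z) * colIncl S := by
          simp only [Matrix.mul_add, Matrix.add_mul, Matrix.mul_assoc]
      _ = 0 := by rw [hZt]; simp
  · rw [cols_eq_mul X, cols_eq_mul Z, Matrix.transpose_mul]
    calc _ = (colIncl Sᶜ)ᵀ * (Xᵀ * Z) * colIncl S := by simp only [Matrix.mul_assoc]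
      _ = 0 := by
        rw [hZ, Matrix.mul_assoc (colMask S), ← Matrix.mul_assoc _ (colMask S),
          transpose_cols_one_compl_mul_colMask]
        simp

/-- The difference has the form X((1 - J)Xᵀξ + JH)P, where J masks `S`, P selects its columns and
`H` is symmetric. The first term pairs to zero because `t` is orthogonal to the frozen columns, the
second because `X_Sᵀ t` is antisymmetric. -/
theorem frobInner_cols_sub_blockOp (hX : Xᵀ * X = 1) (ξ : Matrix (Fin n) (Fin p) ℝ)
    (S : Finset (Fin p)) {t} (ht : t ∈ blockTangent X S) :
    frobInner (cols ξ S - cols (blockOp X S (tangentPart X ξ)) S) t = 0 := by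
  obtain ⟨h1, h2⟩ := blockTangent_eq X S ht
  set P : Matrix (Fin p) S ℝ := colIncl S with hP
  set H : Matrix (Fin p) (Fin p) ℝ := (1 / 2 : ℝ) • (Xᵀ * ξ + ξᵀ * X) with hH
  have hHt : Hᵀ = H := by
    simp only [hH, Matrix.transpose_smul, Matrix.transpose_add, Matrix.transpose_mul,
      Matrix.transpose_transpose, add_comm]
  have hXt : Xᵀ * tangentPart X ξ = Xᵀ * ξ - H := by
    rw [tangentPart, Matrix.mul_sub, ← Matrix.mul_assoc Xᵀ X, hX, Matrix.one_mul]
  have h3 : colMask Sᶜ * (Xᵀ * t) = 0 := by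
    rw [← cols_one_mul_transpose, Matrix.mul_assoc, ← Matrix.mul_assoc _ Xᵀ t,
      ← Matrix.transpose_mul, h2, Matrix.mul_zero]
  have hJ : colMask S * P = P := colMask_mul_cols_one S
  have h4 : cols ξ S - cols (blockOp X S (tangentPart X ξ)) S =
      X * ((colMask Sᶜ * (Xᵀ * ξ) + colMask S * H) * P) := by
    rw [cols_eq_mul ξ, cols_eq_mul (blockOp X S _), ← hP, blockOp_apply_eq, hXt, tangentPart, ← hH,
      colMask_compl]
    simp only [Matrix.add_mul, Matrix.sub_mul, Matrix.mul_assoc, hJ, Matrix.mul_add, Matrix.mul_sub,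
      Matrix.one_mul]
    abel
  have h5 : frobInner (colMask Sᶜ * (Xᵀ * ξ) * P) (Xᵀ * t) = 0 := by
    rw [Matrix.mul_assoc, frobInner_mul_left, transpose_colMask, h3]
    simp [frobInner]
  have h6 : frobInner (colMask S * H * P) (Xᵀ * t) = 0 := by
    have h7 : colMask S * H * P = P * (Pᵀ * H * P) := by
      rw [← cols_one_mul_transpose]; simp only [Matrix.mul_assoc, hP]
    have h8 : Pᵀ * (Xᵀ * t) = -(tᵀ * (X * P)) := by
      rw [← Matrix.mul_assoc, ← Matrix.transpose_mul]
      exact eq_neg_of_add_eq_zero_right h1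
    have h9 : (Pᵀ * (Xᵀ * t))ᵀ = -(Pᵀ * (Xᵀ * t)) := by
      rw [h8, neg_neg]
      rw [← h8]
      simp [Matrix.transpose_mul, Matrix.mul_assoc]
    have h10 := frobInner_transpose (Pᵀ * H * P) (Pᵀ * (Xᵀ * t))
    rw [h9, frobInner_neg_right] at h10
    rw [h7, frobInner_mul_left]
    have h11 : (Pᵀ * H * P)ᵀ = Pᵀ * H * P := by
      simp [Matrix.transpose_mul, hHt, Matrix.mul_assoc]
    rw [h11] at h10
    linarith
  rw [h4, frobInner_mul_left, Matrix.add_mul, frobInner_add_left, h5, h6, add_zero]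

/-- By orthogonality the nearest tangent point is unique. All partial Riemannian subgradients are
thus block projections of the one vector `tangentPart X ξ`, which is what allows averaging over
pairs. -/
theorem eq_cols_blockOp_of_mem_proj (hX : Xᵀ * X = 1) (S : Finset (Fin p)) {ζ}
    (hζ : ζ ∈ proj (blockTangent X S) (cols ξ S)) :
    ζ = cols (blockOp X S (tangentPart X ξ)) S := by
  obtain ⟨hm, hd⟩ := hζ
  have h0 := cols_blockOp_mem_blockTangent hX ξ S
  set ζ₀ := cols (blockOp X S (tangentPart X ξ)) S
  have h1 := Metric.infDist_le_dist_of_mem (x := cols ξ S) h0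
  rw [← hd, dist_eq_norm] at h1
  have h2 : frobInner (cols ξ S - ζ₀) (ζ₀ - ζ) = 0 := by
    rw [frobInner_sub_right, frobInner_cols_sub_blockOp hX ξ S h0,
      frobInner_cols_sub_blockOp hX ξ S hm, sub_zero]
  have h3 := norm_add_sq_frob (cols ξ S - ζ₀) (ζ₀ - ζ)
  rw [h2, sub_add_sub_cancel] at h3
  have h4 : ‖cols ξ S - ζ‖ ^ 2 ≤ ‖cols ξ S - ζ₀‖ ^ 2 := by gcongr
  have h5 : ‖ζ₀ - ζ‖ = 0 := by nlinarith [norm_nonneg (ζ₀ - ζ)]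
  exact (sub_eq_zero.1 (norm_eq_zero.1 h5)).symm

theorem IsStep.mem_stiefel (hX : Xᵀ * X = 1) (h : IsStep C γ X ξ s X') : X'ᵀ * X' = 1 := by
  unfold IsStep at h
  generalize pairCols C s = S at h
  obtain ⟨ζ, -, ⟨⟨h1, h2⟩, -⟩, h3⟩ := h
  rw [Stiefel, Set.mem_ofPred_eq] at h1
  rw [cols_eq_mul X' Sᶜ, cols_eq_mul X Sᶜ] at h3
  rw [cols_eq_mul X] at h2
  set P : Matrix (Fin p) S ℝ := colIncl S with hP
  set P' : Matrix (Fin p) (Sᶜ : Finset (Fin p)) ℝ := colIncl Sᶜ with hP'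
  have hone : P * Pᵀ + P' * P'ᵀ = 1 := by
    rw [cols_one_mul_transpose, cols_one_mul_transpose, colMask_compl]; abel
  set A := cols X' S with hA
  have h2' : Aᵀ * (X * P') = 0 := by
    have := congrArg Matrix.transpose h2
    simpa [Matrix.transpose_mul] using this
  have h4 : X' = A * Pᵀ + X * P' * P'ᵀ := by
    rw [← h3, hA, cols_eq_mul X' S, ← hP, Matrix.mul_assoc, Matrix.mul_assoc, ← Matrix.mul_add,
      hone, Matrix.mul_one]
  have h5 : (X * P')ᵀ * (X * P') = 1 := by
    rw [Matrix.transpose_mul, Matrix.mul_assoc, ← Matrix.mul_assoc Xᵀ, hX, Matrix.one_mul,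
      transpose_cols_one_mul]
  rw [h4]
  calc (A * Pᵀ + X * P' * P'ᵀ)ᵀ * (A * Pᵀ + X * P' * P'ᵀ)
      = P * (Aᵀ * A) * Pᵀ + P * (Aᵀ * (X * P')) * P'ᵀ + P' * ((X * P')ᵀ * A) * Pᵀ +
          P' * ((X * P')ᵀ * (X * P')) * P'ᵀ := by
        generalize X * P' = B
        simp only [Matrix.transpose_add, Matrix.transpose_mul, Matrix.transpose_transpose,
          Matrix.add_mul, Matrix.mul_add, Matrix.mul_assoc]
        abel
    _ = 1 := by rw [h1, h2, h2', h5]; simpa using hone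

/-- The nearest point is no farther than the polar factor of the tangent step, whose Gram matrix
differs from the identity only by γ²ζᵀζ. -/
theorem IsStep.norm_sub_le (hX : Xᵀ * X = 1) (h : IsStep C γ X ξ s X') :
    ‖X' - (X - γ • blockOp X (pairCols C s) (tangentPart X ξ))‖ ≤
      γ ^ 2 / 2 * ‖blockOp X (pairCols C s) (tangentPart X ξ)‖ ^ 2 := by
  unfold IsStep at h
  generalize pairCols C s = S at h ⊢
  obtain ⟨ζ, hζ, ⟨-, h1⟩, h2⟩ := h
  have ht := blockTangent_eq X S hζ.1
  have hζ' := eq_cols_blockOp_of_mem_proj hX S hζ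
  have hZJ := blockOp_mul_colMask X (tangentPart X ξ) S
  set Z := blockOp X S (tangentPart X ξ) with hZ
  set P : Matrix (Fin p) S ℝ := colIncl S with hP
  set P' : Matrix (Fin p) (Sᶜ : Finset (Fin p)) ℝ := colIncl Sᶜ with hP'
  have hPP : Pᵀ * P = 1 := transpose_cols_one_mul S
  have hone : P * Pᵀ + P' * P'ᵀ = 1 := by
    rw [cols_one_mul_transpose, cols_one_mul_transpose, colMask_compl]; abel
  rw [cols_eq_mul X' Sᶜ, cols_eq_mul X Sᶜ, ← hP'] at h2
  rw [cols_eq_mul X' S, cols_eq_mul X S, ← hP] at h1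
  obtain ⟨ht1, ht2⟩ := ht
  set W := X * P - γ • ζ with hW
  have hXP : (X * P)ᵀ * (X * P) = 1 := by
    rw [Matrix.transpose_mul, Matrix.mul_assoc, ← Matrix.mul_assoc Xᵀ, hX, Matrix.one_mul, hPP]
  have hWW : Wᵀ * W = 1 + γ ^ 2 • (ζᵀ * ζ) := by
    have : Wᵀ * W = (X * P)ᵀ * (X * P) - γ • (ζᵀ * (X * P) + (X * P)ᵀ * ζ) + γ ^ 2 • (ζᵀ * ζ) := by
      rw [hW]
      simp only [Matrix.transpose_sub, Matrix.transpose_smul, Matrix.sub_mul, Matrix.mul_sub,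
        Matrix.smul_mul, Matrix.mul_smul]
      module
    rw [this, ht1, hXP]; simp
  -- The Gram matrix dominates the identity, so `r = 1` is allowed; this gives the factor 1/2.
  obtain ⟨B, hB1, hB2⟩ := exists_polar_factor (W := W) one_pos (by
    intro x
    rw [← frobInner_self (W * x), frobInner_mul_left, ← Matrix.mul_assoc, hWW, Matrix.add_mul,
      frobInner_add_right, Matrix.one_mul, frobInner_self, Matrix.smul_mul, frobInner_smul_right,
      Matrix.mul_assoc, ← frobInner_mul_left, frobInner_self]
    nlinarith [mul_nonneg (sq_nonneg γ) (sq_nonneg ‖ζ * x‖)])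
  -- Right multiplication preserves the column space, so the polar factor stays orthogonal to the
  -- frozen columns.
  have hmem : W * B ∈ submanifoldBlock X S := by
    refine ⟨hB1, ?_⟩
    rw [cols_eq_mul X, ← Matrix.mul_assoc, hW, Matrix.mul_sub, Matrix.mul_smul, ht2,
      Matrix.transpose_mul, Matrix.mul_assoc, ← Matrix.mul_assoc Xᵀ, hX, Matrix.one_mul,
      transpose_cols_one_compl_mul]
    simp
  have h3 := Metric.infDist_le_dist_of_mem (x := W) hmem
  rw [← h1, dist_eq_norm] at h3
  have h4 : ‖Wᵀ * W - 1‖ ≤ γ ^ 2 * ‖ζ‖ ^ 2 := by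
    rw [hWW, add_sub_cancel_left, norm_smul, Real.norm_of_nonneg (sq_nonneg γ)]
    gcongr
    exact (Matrix.frobenius_norm_mul _ _).trans (by rw [Matrix.frobenius_norm_transpose, sq])
  have h5 : ‖ζ‖ ≤ ‖Z‖ := by
    rw [hζ', cols_eq_mul, ← hP]
    simpa using norm_transpose_mul_le' hPP Zᵀ
  have h6 : X' - (X - γ • Z) = (X' * P - W) * Pᵀ := by
    have h7 : Z * P' = 0 := by
      rw [← hZJ, Matrix.mul_assoc, colMask_mul_cols_one_compl, Matrix.mul_zero]
    calc X' - (X - γ • Z) = (X' - (X - γ • Z)) * (P * Pᵀ + P' * P'ᵀ) := by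
          rw [hone, Matrix.mul_one]
      _ = (X' * P - (X * P - γ • (Z * P))) * Pᵀ +
            (X' * P' - (X * P' - γ • (Z * P'))) * P'ᵀ := by
          simp only [Matrix.mul_add, Matrix.sub_mul, Matrix.smul_mul, Matrix.mul_assoc]
      _ = (X' * P - W) * Pᵀ := by rw [h7, h2, hW, hζ', cols_eq_mul Z, ← hP]; simp
  have h8 : ‖(X' * P - W) * Pᵀ‖ = ‖X' * P - W‖ := by
    rw [← Matrix.frobenius_norm_transpose, Matrix.transpose_mul, Matrix.transpose_transpose,
      norm_mul_of_stiefel hPP, Matrix.frobenius_norm_transpose]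
  rw [h6, h8, norm_sub_rev]
  have h9 : γ ^ 2 * ‖ζ‖ ^ 2 ≤ γ ^ 2 * ‖Z‖ ^ 2 := by gcongr
  linarith

end Step

/-! ### Clarke subgradients of weakly convex Lipschitz functions -/

section Clarke

variable {m ι : Type*} [Fintype m] [Fintype ι] {f : Matrix m ι ℝ → ℝ} {U : Set (Matrix m ι ℝ)}
  {τ L : ℝ} {X Y ξ : Matrix m ι ℝ}

theorem WeaklyConvexOn.le (hf : WeaklyConvexOn τ U f) {A B : Matrix m ι ℝ} (hA : A ∈ U)
    (hB : B ∈ U) {t : ℝ} (h0 : 0 ≤ t) (h1 : t ≤ 1) :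
    f (A + t • (B - A)) ≤ (1 - t) * f A + t * f B + τ / 2 * (t * (1 - t)) * ‖B - A‖ ^ 2 := by
  have h := hf.2 hA hB (sub_nonneg.2 h1) h0 (by ring)
  have h2 : (1 - t) • A + t • B = A + t • (B - A) := by module
  have h3 : ‖A + t • (B - A)‖ ^ 2 =
      (1 - t) * ‖A‖ ^ 2 + t * ‖B‖ ^ 2 - t * (1 - t) * ‖B - A‖ ^ 2 := by
    rw [norm_add_sq_frob, frobInner_smul_right, frobInner_sub_right, frobInner_self, norm_smul,
      mul_pow, Real.norm_eq_abs, sq_abs, norm_sub_sq_frob, frobInner_comm B A]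
    ring
  simp only [h2, h3, smul_eq_mul] at h
  linarith

theorem continuousAt_of_lipschitz_nhds (hU : U ∈ 𝓝 X)
    (hfL : ∀ X ∈ U, ∀ Y ∈ U, |f X - f Y| ≤ L * ‖X - Y‖) : ContinuousAt f X := by
  rw [ContinuousAt, tendsto_iff_norm_sub_tendsto_zero]
  have h1 : Tendsto (fun Y => L * ‖Y - X‖) (𝓝 X) (𝓝 0) := by
    have : Continuous fun Y => L * ‖Y - X‖ := by fun_prop
    simpa using this.tendsto X
  refine squeeze_zero' (Eventually.of_forall fun _ => norm_nonneg _) ?_ h1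
  filter_upwards [hU] with Y hY
  exact hfL Y hY X (mem_of_mem_nhds hU)

theorem tendsto_add_smul_nhds {m ι : Type*} (X V : Matrix m ι ℝ) :
    Tendsto (fun q : Matrix m ι ℝ × ℝ => q.1 + q.2 • V) (𝓝 X ×ˢ 𝓝[>] (0 : ℝ)) (𝓝 X) := by
  have h : Continuous fun q : Matrix m ι ℝ × ℝ => q.1 + q.2 • V := by fun_prop
  have h2 := h.tendsto (X, 0)
  simp only [zero_smul, add_zero] at h2
  rw [nhds_prod_eq] at h2
  exact h2.mono_left (Filter.prod_mono le_rfl nhdsWithin_le_nhds)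

/-- Testing the definition in the direction `ξ` itself gives ‖ξ‖² ≤ L‖ξ‖. -/
theorem norm_le_of_mem_clarkeSubdiff (hL : 0 ≤ L) (hU : U ∈ 𝓝 X)
    (hfL : ∀ X ∈ U, ∀ Y ∈ U, |f X - f Y| ≤ L * ‖X - Y‖) (hξ : ξ ∈ clarkeSubdiff f X) :
    ‖ξ‖ ≤ L := by
  have h1 : clarkeDeriv f X ξ ≤ ((L * ‖ξ‖ : ℝ) : EReal) := by
    refine limsup_le_of_le (by isBoundedDefault) ?_
    filter_upwards [tendsto_fst.eventually hU, (tendsto_add_smul_nhds X ξ).eventually hU,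
      tendsto_snd.eventually self_mem_nhdsWithin] with q h2 h3 h4
    have h4' : 0 < q.2 := h4
    rw [EReal.coe_le_coe_iff, div_le_iff₀ h4']
    have h5 := hfL _ h3 _ h2
    rw [add_sub_cancel_left, norm_smul, Real.norm_of_nonneg h4'.le] at h5
    linarith [le_abs_self (f (q.1 + q.2 • ξ) - f q.1)]
  have h2 := (hξ ξ).trans h1
  rw [EReal.coe_le_coe_iff, frobInner_self] at h2
  by_contra! h3
  nlinarith [norm_nonneg ξ]

/-- Weak convexity bounds every nearby difference quotient at Z in direction V by f(Z + V) - f(Z) +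
τ‖V‖²/2. This bound is free of the stepsize and continuous at `X`, so it controls the upper limit.
-/
theorem frobInner_le_of_mem_clarkeSubdiff (hτ : 0 ≤ τ) (hf : WeaklyConvexOn τ U f)
    (hU : U ∈ 𝓝 X) (hUY : U ∈ 𝓝 Y)
    (hfL : ∀ X ∈ U, ∀ Y ∈ U, |f X - f Y| ≤ L * ‖X - Y‖) (hξ : ξ ∈ clarkeSubdiff f X) :
    frobInner ξ (Y - X) ≤ f Y - f X + τ / 2 * ‖Y - X‖ ^ 2 := by
  set V := Y - X with hV
  have hXV : X + V = Y := by rw [hV]; abel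
  have hadd : Tendsto (fun Z : Matrix m ι ℝ => Z + V) (𝓝 X) (𝓝 Y) := by
    have : Continuous fun Z : Matrix m ι ℝ => Z + V := by fun_prop
    simpa [hXV] using this.tendsto X
  set g : Matrix m ι ℝ → ℝ := fun Z => f (Z + V) - f Z + τ / 2 * ‖V‖ ^ 2 with hg
  have hgt : Tendsto g (𝓝 X) (𝓝 (f Y - f X + τ / 2 * ‖V‖ ^ 2)) :=
    (((continuousAt_of_lipschitz_nhds hUY hfL).tendsto.comp hadd).sub
      (continuousAt_of_lipschitz_nhds hU hfL).tendsto).add_const _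
  have h1 : clarkeDeriv f X V ≤ ((f Y - f X + τ / 2 * ‖V‖ ^ 2 : ℝ) : EReal) := by
    have h2 : Tendsto (fun q : Matrix m ι ℝ × ℝ => ((g q.1 : ℝ) : EReal))
        (𝓝 X ×ˢ 𝓝[>] (0 : ℝ)) (𝓝 ((f Y - f X + τ / 2 * ‖V‖ ^ 2 : ℝ) : EReal)) :=
      (continuous_coe_real_ereal.tendsto _).comp (hgt.comp tendsto_fst)
    rw [← h2.limsup_eq]
    refine limsup_le_limsup ?_ (by isBoundedDefault) (by isBoundedDefault)
    have h01 : Set.Ioo (0 : ℝ) 1 ∈ 𝓝[>] (0 : ℝ) := Ioo_mem_nhdsGT one_pos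
    filter_upwards [tendsto_fst.eventually hU, tendsto_fst.eventually (hadd.eventually hUY),
      tendsto_snd.eventually h01] with q h3 h4 h5
    rw [EReal.coe_le_coe_iff, div_le_iff₀ h5.1]
    have h6 := hf.le h3 h4 h5.1.le h5.2.le
    rw [add_sub_cancel_left] at h6
    have h7 : 0 ≤ τ / 2 * ‖V‖ ^ 2 * q.2 ^ 2 := by positivity
    simp only [hg]
    nlinarith
  have h2 := (hξ V).trans h1
  rwa [EReal.coe_le_coe_iff] at h2

variable [DecidableEq ι]

theorem transpose_mul_sub_add {m ι : Type*} [Fintype m] [DecidableEq ι] {X Y : Matrix m ι ℝ}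
    (hX : Xᵀ * X = 1) (hY : Yᵀ * Y = 1) :
    Xᵀ * (Y - X) + (Y - X)ᵀ * X = -((Y - X)ᵀ * (Y - X)) := by
  simp only [Matrix.mul_sub, Matrix.transpose_sub, Matrix.sub_mul, hX, hY]
  abel

/-- The discarded normal part is X times a symmetric matrix, and between Stiefel points the
symmetric part of XᵀE, with E = Y - X, is -EᵀE/2. Replacing `ξ` by its tangent part therefore costs
only L‖E‖²/2. -/
theorem frobInner_tangentPart_le (hτ : 0 ≤ τ) (hL : 0 ≤ L) (hf : WeaklyConvexOn τ U f)
    (hU : U ∈ 𝓝 X) (hUY : U ∈ 𝓝 Y)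
    (hfL : ∀ X ∈ U, ∀ Y ∈ U, |f X - f Y| ≤ L * ‖X - Y‖) (hξ : ξ ∈ clarkeSubdiff f X)
    (hX : Xᵀ * X = 1) (hY : Yᵀ * Y = 1) :
    frobInner (tangentPart X ξ) (Y - X) ≤ f Y - f X + (τ + L) / 2 * ‖Y - X‖ ^ 2 := by
  have h1 := frobInner_le_of_mem_clarkeSubdiff hτ hf hU hUY hfL hξ
  have h2 := norm_le_of_mem_clarkeSubdiff hL hU hfL hξ
  have hE := transpose_mul_sub_add hX hY
  set E := Y - X
  have h3 : frobInner (X * ((1 / 2 : ℝ) • (Xᵀ * ξ + ξᵀ * X))) E =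
      -(1 / 2 * frobInner (Xᵀ * ξ) (Eᵀ * E)) := by
    have h4 : frobInner (ξᵀ * X) (Xᵀ * E) = frobInner (Xᵀ * ξ) (Eᵀ * X) := by
      rw [← frobInner_transpose]; simp [Matrix.transpose_mul]
    have h5 : Eᵀ * E = -(Xᵀ * E + Eᵀ * X) := by rw [hE, neg_neg]
    rw [frobInner_mul_left, frobInner_smul_left, frobInner_add_left, h4, h5, frobInner_neg_right,
      frobInner_add_right]
    ring
  have h6 : |frobInner (Xᵀ * ξ) (Eᵀ * E)| ≤ L * ‖E‖ ^ 2 := by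
    refine (abs_frobInner_le _ _).trans ?_
    have h7 := norm_transpose_mul_le hX ξ
    have h8 : ‖Eᵀ * E‖ ≤ ‖E‖ ^ 2 :=
      (Matrix.frobenius_norm_mul _ _).trans (by rw [Matrix.frobenius_norm_transpose, sq])
    exact mul_le_mul (h7.trans h2) h8 (norm_nonneg _) hL
  rw [tangentPart, frobInner_sub_left, h3]
  linarith [(abs_le.1 h6).2]

end Clarke

/-! ### Quadratic growth of the proximal objective at a minimizer -/

section Growth

variable {n p ℓ : ℕ} {c : Fin p → Fin ℓ} {X Y Z : Matrix (Fin n) (Fin p) ℝ}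

/-- The bilinear form of the quadratic form `blockQuad`. -/
def blockBilin (c : Fin p → Fin ℓ) (X u v : Matrix (Fin n) (Fin p) ℝ) : ℝ :=
  frobInner u v + ((ℓ : ℝ) - 2) * frobInner (offBlock c (Xᵀ * u)) (offBlock c (Xᵀ * v))

theorem blockQuad_add_smul (c : Fin p → Fin ℓ) (X u v : Matrix (Fin n) (Fin p) ℝ) (t : ℝ) :
    blockQuad c X (u + t • v) =
      blockQuad c X u + 2 * t * blockBilin c X u v + t ^ 2 * blockQuad c X v := by
  simp only [blockQuad, blockBilin, Matrix.mul_add, offBlock_add, Matrix.mul_smul, offBlock_smul,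
    norm_add_sq_frob, frobInner_smul_right, norm_smul, mul_pow, Real.norm_eq_abs, sq_abs]
  ring

theorem blockBilin_le (hℓ : 2 ≤ ℓ) (c : Fin p → Fin ℓ) (hX : Xᵀ * X = 1)
    (u v : Matrix (Fin n) (Fin p) ℝ) : blockBilin c X u v ≤ ((ℓ : ℝ) - 1) * (‖u‖ * ‖v‖) := by
  have h2 : (0 : ℝ) ≤ ℓ - 2 := sub_nonneg.2 (by exact_mod_cast hℓ)
  have hle : ∀ w : Matrix (Fin n) (Fin p) ℝ, ‖offBlock c (Xᵀ * w)‖ ≤ ‖w‖ := fun w =>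
    (norm_offBlock_le c _).trans (norm_transpose_mul_le hX w)
  have h3 := (frobInner_le (offBlock c (Xᵀ * u)) (offBlock c (Xᵀ * v))).trans
    (mul_le_mul (hle u) (hle v) (norm_nonneg _) (norm_nonneg _))
  have h4 := mul_le_mul_of_nonneg_left h3 h2
  have h5 := frobInner_le u v
  rw [blockBilin]; linarith

theorem blockQuad_le (hℓ : 2 ≤ ℓ) (c : Fin p → Fin ℓ) (hX : Xᵀ * X = 1)
    (u : Matrix (Fin n) (Fin p) ℝ) : blockQuad c X u ≤ ((ℓ : ℝ) - 1) * ‖u‖ ^ 2 := by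
  have h := blockBilin_le hℓ c hX u u
  rwa [blockBilin, frobInner_self, frobInner_self, ← sq] at h

/-- The objective function of the adaptive proximal map, for `X` on the Stiefel manifold. -/
def blockObjective (c : Fin p → Fin ℓ) (f : Matrix (Fin n) (Fin p) ℝ → ℝ) (lam : ℝ)
    (X Y : Matrix (Fin n) (Fin p) ℝ) : ℝ :=
  f Y + ℓ / (4 * lam) * blockQuad c X (Y - X)

theorem blockQuad_zero (c : Fin p → Fin ℓ) (X : Matrix (Fin n) (Fin p) ℝ) :
    blockQuad c X 0 = 0 := by
  have h : offBlock c (0 : Matrix (Fin p) (Fin p) ℝ) = 0 := by ext; simp [offBlock]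
  simp [blockQuad, h]

theorem blockObjective_self (c : Fin p → Fin ℓ) (f : Matrix (Fin n) (Fin p) ℝ → ℝ) (lam : ℝ)
    (X : Matrix (Fin n) (Fin p) ℝ) : blockObjective c f lam X X = f X := by
  rw [blockObjective, sub_self, blockQuad_zero, mul_zero, add_zero]

variable {f : Matrix (Fin n) (Fin p) ℝ → ℝ} {U : Set (Matrix (Fin n) (Fin p) ℝ)} {τ L lam : ℝ}

/-- Comparison with `Y = X` gives (ℓ/(4λ))‖Y - X‖² ≤ L‖Y - X‖. -/
theorem norm_sub_le_of_minimizer (hℓ : 2 ≤ ℓ) (hlam : 0 < lam) (hXU : X ∈ U)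
    (hYU : Y ∈ U)
    (hL : 0 ≤ L) (hfL : ∀ X ∈ U, ∀ Y ∈ U, |f X - f Y| ≤ L * ‖X - Y‖)
    (hYX : blockObjective c f lam X Y ≤ blockObjective c f lam X X) :
    ‖Y - X‖ ≤ 4 * lam * L / ℓ := by
  have h2 : (2 : ℝ) ≤ ℓ := by exact_mod_cast hℓ
  have h0 : (0 : ℝ) < ℓ / (4 * lam) := by positivity
  have h3 := norm_sq_le_blockQuad hℓ c X (Y - X)
  have h4 := (abs_le.1 (hfL X hXU Y hYU)).2
  rw [norm_sub_rev] at h4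
  rw [blockObjective_self, blockObjective] at hYX
  have h5 : ℓ / (4 * lam) * ‖Y - X‖ ^ 2 ≤ L * ‖Y - X‖ := by
    have := mul_le_mul_of_nonneg_left h3 h0.le
    linarith
  have h6 : ℓ / (4 * lam) * ‖Y - X‖ ≤ L := by
    by_contra! h
    rcases (norm_nonneg (Y - X)).eq_or_lt with h7 | h7
    · rw [← h7, mul_zero] at h; linarith
    · nlinarith
  rw [le_div_iff₀ (by positivity)]
  rw [div_mul_eq_mul_div, div_le_iff₀ (by positivity)] at h6
  linarith

theorem transpose_mul_add_smul_sub {m ι : Type*} [Fintype m] [Fintype ι]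
    [DecidableEq ι] {Y Z : Matrix m ι ℝ} (hY : Yᵀ * Y = 1) (hZ : Zᵀ * Z = 1) (t : ℝ) :
    (Y + t • (Z - Y))ᵀ * (Y + t • (Z - Y)) = 1 - (t * (1 - t)) • ((Z - Y)ᵀ * (Z - Y)) := by
  have h := transpose_mul_sub_add hY hZ
  have h2 : (Z - Y)ᵀ * Y = -((Z - Y)ᵀ * (Z - Y)) - Yᵀ * (Z - Y) := by rw [← h]; abel
  simp only [Matrix.transpose_add, Matrix.transpose_smul, Matrix.add_mul, Matrix.mul_add,
    Matrix.smul_mul, Matrix.mul_smul, hY, h2]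
  module

/-- On a chord the Gram matrix is 1 - t(1 - t)VᵀV with V = Z - Y, so the singular values are at
least √(1 - t‖V‖²). The denominator is kept exact because its limit 2 as t → 0 matters for the
growth constant. -/
theorem exists_stiefel_near_segment {m ι : Type*} [Fintype m] [Fintype ι]
    [DecidableEq ι] {Y Z : Matrix m ι ℝ} (hY : Yᵀ * Y = 1) (hZ : Zᵀ * Z = 1) {t : ℝ}
    (h0 : 0 < t) (h1 : t ≤ 1) (ht : t * ‖Z - Y‖ ^ 2 < 1) :
    ∃ δ : Matrix m ι ℝ, (Y + t • (Z - Y) + δ)ᵀ * (Y + t • (Z - Y) + δ) = 1 ∧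
      ‖δ‖ ≤ t * (‖Z - Y‖ ^ 2 / (1 + √(1 - t * ‖Z - Y‖ ^ 2))) := by
  have hWW := transpose_mul_add_smul_sub hY hZ t
  set V := Z - Y
  set W := Y + t • V
  have ht1 : 0 ≤ t * (1 - t) := mul_nonneg h0.le (by linarith)
  have ht2 : t * (1 - t) ≤ t := by nlinarith
  have hr : 0 < √(1 - t * ‖V‖ ^ 2) := Real.sqrt_pos.2 (by linarith)
  obtain ⟨B, hB1, hB2⟩ := exists_polar_factor (W := W) hr (by
    intro x
    rw [Real.sq_sqrt (by linarith), ← frobInner_self (W * x), frobInner_mul_left,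
      ← Matrix.mul_assoc, hWW, Matrix.sub_mul, frobInner_sub_right, Matrix.one_mul, frobInner_self,
      Matrix.smul_mul, frobInner_smul_right, Matrix.mul_assoc, ← frobInner_mul_left,
      frobInner_self]
    have h2 : ‖V * x‖ ^ 2 ≤ ‖V‖ ^ 2 * ‖x‖ ^ 2 := by
      rw [← mul_pow]
      gcongr
      exact Matrix.frobenius_norm_mul _ _
    have h3 : t * (1 - t) * ‖V * x‖ ^ 2 ≤ t * (‖V‖ ^ 2 * ‖x‖ ^ 2) := by gcongr
    linarith)
  refine ⟨W * B - W, by rw [add_sub_cancel]; exact hB1, ?_⟩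
  rw [norm_sub_rev, mul_div_assoc', le_div_iff₀ (by positivity), mul_comm]
  refine hB2.trans ?_
  rw [hWW, sub_sub_cancel_left, norm_neg, norm_smul, Real.norm_of_nonneg ht1]
  have h8 : ‖Vᵀ * V‖ ≤ ‖V‖ ^ 2 :=
    (Matrix.frobenius_norm_mul _ _).trans (by rw [Matrix.frobenius_norm_transpose, sq])
  gcongr

/-- Minimality of `Y` is tested at the polar factor of Y + t(Z - Y), divided by t, and t tends to 0.
-/
theorem blockObjective_growth (hℓ : 2 ≤ ℓ) (hlam : 0 < lam) (hL : 0 ≤ L)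
    (hf : WeaklyConvexOn τ U f) (hfL : ∀ X ∈ U, ∀ Y ∈ U, |f X - f Y| ≤ L * ‖X - Y‖)
    (hSU : Stiefel (Fin n) (Fin p) ⊆ U) (hX : X ∈ Stiefel (Fin n) (Fin p))
    (hY : Y ∈ Stiefel (Fin n) (Fin p)) (hZ : Z ∈ Stiefel (Fin n) (Fin p))
    (hmin : ∀ Z ∈ Stiefel (Fin n) (Fin p), blockObjective c f lam X Y ≤ blockObjective c f lam X Z) :
    blockObjective c f lam X Y +
        (ℓ / (2 * lam) - τ - (2 * ℓ - 1) * L) / 2 * ‖Z - Y‖ ^ 2 ≤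
      blockObjective c f lam X Z := by
  have h2 : (2 : ℝ) ≤ ℓ := by exact_mod_cast hℓ
  have hK : (0 : ℝ) < ℓ / (4 * lam) := by positivity
  have hYX := norm_sub_le_of_minimizer hℓ hlam (hSU hX) (hSU hY) hL hfL (hmin X hX)
  set V := Z - Y with hV
  set D := blockObjective c f lam X Z - blockObjective c f lam X Y with hD
  -- t Φ(t) bounds the increase of the objective from `Y` to the corrected chord point. At t = 0 the
  -- correction costs (‖V‖²/2)(L + 2(ℓ-1)L): one L from the Lipschitz bound of f, the rest from the
  -- cross term of the quadratic form with ‖Y - X‖ ≤ 4λL/ℓ.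
  let Φ : ℝ → ℝ := fun t => D + (τ / 2 - ℓ / (4 * lam)) * (1 - t) * ‖V‖ ^ 2 +
    ‖V‖ ^ 2 / (1 + √(1 - t * ‖V‖ ^ 2)) *
      (L + ℓ / (4 * lam) * ((ℓ - 1) * (2 * (4 * lam * L / ℓ + t * ‖V‖) + t * ‖V‖ ^ 2)))
  have hΦc : Continuous Φ := by
    have : ∀ t : ℝ, 1 + √(1 - t * ‖V‖ ^ 2) ≠ 0 := fun t => by positivity
    fun_prop (disch := assumption)
  have hΦ0 : Φ 0 = D - (ℓ / (2 * lam) - τ - (2 * ℓ - 1) * L) / 2 * ‖V‖ ^ 2 := by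
    simp only [Φ, zero_mul, sub_zero, Real.sqrt_one]
    field_simp
    ring
  have hΦt : Tendsto Φ (𝓝[>] 0) (𝓝 (Φ 0)) := (hΦc.tendsto 0).mono_left nhdsWithin_le_nhds
  have hnear : ∀ᶠ t in 𝓝[>] (0 : ℝ), t * ‖V‖ ^ 2 < 1 := by
    have hc : Continuous fun t : ℝ => t * ‖V‖ ^ 2 := by fun_prop
    have := (hc.tendsto 0).eventually (gt_mem_nhds (show (0 : ℝ) * ‖V‖ ^ 2 < 1 by simp))
    exact this.filter_mono nhdsWithin_le_nhds
  have h01 : Set.Ioo (0 : ℝ) 1 ∈ 𝓝[>] (0 : ℝ) := Ioo_mem_nhdsGT one_pos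
  have hpos : 0 ≤ Φ 0 := by
    refine ge_of_tendsto hΦt ?_
    filter_upwards [hnear, h01] with t ht h01
    obtain ⟨h0, h1⟩ := h01
    obtain ⟨δ, hδ1, hδ2⟩ := exists_stiefel_near_segment hY hZ h0 h1.le ht
    rw [← hV] at hδ1 hδ2
    set q := ‖V‖ ^ 2 / (1 + √(1 - t * ‖V‖ ^ 2)) with hq
    have hq0 : 0 ≤ q := by positivity
    have hqV : q ≤ ‖V‖ ^ 2 := by
      apply div_le_self (by positivity)
      linarith [Real.sqrt_nonneg (1 - t * ‖V‖ ^ 2)]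
    -- The chord leaves the manifold but not the convex set `U`, where the bounds on f hold.
    have hWU : Y + t • V ∈ U := hf.1.add_smul_sub_mem (hSU hY) (hSU hZ) ⟨h0.le, h1.le⟩
    have hg1 := hmin _ hδ1
    have hf1 := (abs_le.1 (hfL _ (hSU hδ1) _ hWU)).2
    rw [add_sub_cancel_left] at hf1
    have hf2 := hf.le (hSU hY) (hSU hZ) h0.le h1.le
    rw [← hV] at hf2
    have hQ1 := blockQuad_add_smul c X (Y + t • V - X) δ 1
    rw [one_smul] at hQ1
    have hQ2 := blockQuad_add_smul c X (Y - X) V t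
    have hQ3 := blockQuad_add_smul c X (Y - X) V 1
    have hQ4 := norm_sq_le_blockQuad hℓ c X V
    have hQ5 := blockBilin_le hℓ c hX (Y + t • V - X) δ
    have hQ6 := blockQuad_le hℓ c hX δ
    have hu : ‖Y + t • V - X‖ ≤ 4 * lam * L / ℓ + t * ‖V‖ := by
      have : Y + t • V - X = (Y - X) + t • V := by abel
      rw [this]
      refine (norm_add_le _ _).trans (add_le_add hYX ?_)
      rw [norm_smul, Real.norm_of_nonneg h0.le]
    have e1 : Y + t • V + δ - X = Y + t • V - X + δ := by abel
    have e2 : Y - X + t • V = Y + t • V - X := by abel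
    have e3 : Y - X + (1 : ℝ) • V = Z - X := by rw [hV, one_smul]; abel
    rw [e2] at hQ2
    rw [e3] at hQ3
    have hfull : blockObjective c f lam X (Y + t • V + δ) ≤
        blockObjective c f lam X Y + t * D + (τ / 2 - ℓ / (4 * lam)) * (t * (1 - t)) * ‖V‖ ^ 2 +
        ‖δ‖ * (L + ℓ / (4 * lam) * ((ℓ - 1) * (2 * (4 * lam * L / ℓ + t * ‖V‖) + ‖δ‖))) := by
      have hb : 2 * 1 * blockBilin c X (Y + t • V - X) δ + 1 ^ 2 * blockQuad c X δ ≤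
          ‖δ‖ * ((ℓ - 1) * (2 * (4 * lam * L / ℓ + t * ‖V‖) + ‖δ‖)) := by
        have h3 : ((ℓ : ℝ) - 1) * (‖Y + t • V - X‖ * ‖δ‖) ≤
            ((ℓ : ℝ) - 1) * ((4 * lam * L / ℓ + t * ‖V‖) * ‖δ‖) := by
          have : (0 : ℝ) ≤ ℓ - 1 := by linarith
          gcongr
        linarith
      -- The quadratic form is strongly convex along the chord because it dominates the squared
      -- norm.
      have hc : blockQuad c X (Y + t • V - X) ≤ blockQuad c X (Y - X) +
          t * (blockQuad c X (Z - X) - blockQuad c X (Y - X)) - t * (1 - t) * ‖V‖ ^ 2 := by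
        have : t * (1 - t) * ‖V‖ ^ 2 ≤ t * (1 - t) * blockQuad c X V := by
          have : (0 : ℝ) ≤ 1 - t := by linarith
          gcongr
        rw [hQ2, hQ3]
        linarith
      have hd := mul_le_mul_of_nonneg_left (add_le_add hb hc) hK.le
      rw [hD]
      simp only [blockObjective, e1, hQ1]
      linarith
    have hδ3 : ‖δ‖ ≤ t * ‖V‖ ^ 2 := hδ2.trans (by gcongr)
    have hlast : ‖δ‖ * (L + ℓ / (4 * lam) * ((ℓ - 1) * (2 * (4 * lam * L / ℓ + t * ‖V‖) + ‖δ‖))) ≤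
        t * q * (L + ℓ / (4 * lam) * ((ℓ - 1) * (2 * (4 * lam * L / ℓ + t * ‖V‖) + t * ‖V‖ ^ 2))) := by
      have : (0 : ℝ) ≤ ℓ - 1 := by linarith
      gcongr
    have h3 : 0 ≤ t * Φ t := by
      simp only [Φ, ← hq]
      linarith
    exact nonneg_of_mul_nonneg_right h3 h0
  rw [hΦ0] at hpos
  linarith

end Growth

/-! ### Change of the adaptive distance in one step and its average over pairs -/

section Descent

variable {n p ℓ : ℕ} {c : Fin p → Fin ℓ} {X X' Y Z ζ : Matrix (Fin n) (Fin p) ℝ} {γ L : ℝ}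

/-- The part of the change of `blockQuad` at `X` that is linear in the update direction `Z`. -/
def linGain (c : Fin p → Fin ℓ) (γ : ℝ) (X Y Z : Matrix (Fin n) (Fin p) ℝ) : ℝ :=
  2 * γ * frobInner (Y - X) Z -
    2 * γ * ((ℓ : ℝ) - 2) * frobInner (offBlock c (Xᵀ * (Y - X))) (Zᵀ * Y)

/-- A bound for the part of the change of `blockQuad` at `X` that is of higher order in the update
direction `Z`. -/
def quadGain (c : Fin p → Fin ℓ) (γ L : ℝ) (X Z : Matrix (Fin n) (Fin p) ℝ) : ℝ :=
  (6 * γ ^ 2 + 3 / 4 * ((ℓ : ℝ) - 2) * γ ^ 4 * L ^ 2) * ‖Z‖ ^ 2 +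
    3 * ((ℓ : ℝ) - 2) * γ ^ 2 * ‖offBlock c (Xᵀ * Z)‖ ^ 2

theorem offBlock_transpose_mul_sub (hX : Xᵀ * X = 1) (c : Fin p → Fin ℓ)
    (Y : Matrix (Fin n) (Fin p) ℝ) : offBlock c (Xᵀ * (Y - X)) = offBlock c (Xᵀ * Y) := by
  rw [Matrix.mul_sub, hX, offBlock_sub, offBlock_one, sub_zero]

/-- Splitting Y as X + (Y - X) isolates `Xᵀ * Z` as the only first-order term without the small
factor ‖Y - X‖. Its block part averages without a factor ℓ-1, which keeps the final γ² constant
independent of ℓ. -/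
theorem norm_offBlock_step_le (hX : Xᵀ * X = 1) (hγ : 0 ≤ γ) (hz1 : γ * ‖Z‖ ≤ 1)
    (hε : ‖X' - (X - γ • Z)‖ ≤ γ ^ 2 / 2 * ‖Z‖ ^ 2) :
    ‖offBlock c ((X' - X)ᵀ * Y)‖ ≤ γ * ‖offBlock c (Xᵀ * Z)‖ + (γ * ‖Z‖) ^ 2 / 2 +
      3 / 2 * (γ * ‖Z‖) * ‖Y - X‖ := by
  have hΔ : ‖X' - X‖ ≤ 3 / 2 * (γ * ‖Z‖) := by
    have e : X' - X = (X' - (X - γ • Z)) + -(γ • Z) := by abel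
    have h := norm_add_le (X' - (X - γ • Z)) (-(γ • Z))
    rw [← e, norm_neg, norm_smul, Real.norm_of_nonneg hγ] at h
    nlinarith [mul_nonneg hγ (norm_nonneg Z)]
  have e : (X' - X)ᵀ * Y = (X' - X)ᵀ * (Y - X) + (X' - (X - γ • Z))ᵀ * X - γ • (Zᵀ * X) := by
    simp only [Matrix.transpose_sub, Matrix.transpose_smul, Matrix.sub_mul, Matrix.mul_sub,
      Matrix.smul_mul]
    abel
  have h1 : ‖offBlock c ((X' - X)ᵀ * (Y - X))‖ ≤ 3 / 2 * (γ * ‖Z‖) * ‖Y - X‖ := by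
    refine (norm_offBlock_le c _).trans ((Matrix.frobenius_norm_mul _ _).trans ?_)
    rw [Matrix.frobenius_norm_transpose]
    gcongr
  have h2 : ‖offBlock c ((X' - (X - γ • Z))ᵀ * X)‖ ≤ (γ * ‖Z‖) ^ 2 / 2 := by
    refine (norm_offBlock_le c _).trans ((norm_transpose_mul_le' hX _).trans (hε.trans ?_))
    rw [mul_pow]; linarith
  have h3 : ‖offBlock c (Zᵀ * X)‖ = ‖offBlock c (Xᵀ * Z)‖ := by
    rw [← Matrix.frobenius_norm_transpose, transpose_offBlock]
    simp [Matrix.transpose_mul]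
  rw [e, offBlock_sub, offBlock_add, offBlock_smul]
  refine (norm_sub_le _ _).trans ?_
  rw [norm_smul, Real.norm_of_nonneg hγ, h3]
  linarith [norm_add_le (offBlock c ((X' - X)ᵀ * (Y - X))) (offBlock c ((X' - (X - γ • Z))ᵀ * X))]

/-- The γ²‖Z‖² terms add up to 9/4 + 2/3 from the distance and 1 + 9/8 from the blocks, which is
below 6. -/
theorem blockQuad_step_le (hℓ : 2 ≤ ℓ) (hX : Xᵀ * X = 1) (hX' : X'ᵀ * X' = 1) (hY : Yᵀ * Y = 1)
    (hγ : 0 ≤ γ) (hγL : γ * L ≤ 1) (hZL : ‖Z‖ ≤ L)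
    (hε : ‖X' - (X - γ • Z)‖ ≤ γ ^ 2 / 2 * ‖Z‖ ^ 2) (he : (2 * (ℓ : ℝ) - 1) * ‖Y - X‖ ≤ 2) :
    blockQuad c X' (Y - X') ≤
      blockQuad c X (Y - X) + linGain c γ X Y Z + quadGain c γ L X Z := by
  have h2 : (0 : ℝ) ≤ ℓ - 2 := sub_nonneg.2 (by exact_mod_cast hℓ)
  have hz1 : γ * ‖Z‖ ≤ 1 := (mul_le_mul_of_nonneg_left hZL hγ).trans hγL
  have hoff := norm_offBlock_step_le (c := c) (Y := Y) hX hγ hz1 hε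
  have hz0 : 0 ≤ γ * ‖Z‖ := by positivity
  have hE0 := norm_nonneg (Y - X)
  have he1 : ‖Y - X‖ ≤ 2 / 3 := by nlinarith
  have he2 : ((ℓ : ℝ) - 2) * ‖Y - X‖ ≤ 1 := by nlinarith
  -- The bound is 24(ℓ-2) ≤ (2ℓ-1)², whose gap is (2ℓ-7)².
  have he3 : ((ℓ : ℝ) - 2) * ‖Y - X‖ ^ 2 ≤ 1 / 6 := by
    have h3 : ((2 * (ℓ : ℝ) - 1) * ‖Y - X‖) ^ 2 ≤ 2 ^ 2 := by
      have : 0 ≤ (2 * (ℓ : ℝ) - 1) * ‖Y - X‖ := mul_nonneg (by linarith) hE0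
      gcongr
    nlinarith [mul_nonneg (sq_nonneg (2 * (ℓ : ℝ) - 7)) (sq_nonneg ‖Y - X‖)]
  set ε := X' - (X - γ • Z) with hεd
  have hε' : ‖ε‖ ≤ (γ * ‖Z‖) ^ 2 / 2 := hε.trans (by rw [mul_pow]; linarith)
  have hΔ : ‖X' - X‖ ≤ 3 / 2 * (γ * ‖Z‖) := by
    have e : X' - X = ε + -(γ • Z) := by rw [hεd]; abel
    have h := norm_add_le ε (-(γ • Z))
    rw [← e, norm_neg, norm_smul, Real.norm_of_nonneg hγ] at h
    nlinarith
  have e1 : X' - X = ε - γ • Z := by rw [hεd]; abel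
  have hd : ‖Y - X'‖ ^ 2 ≤ ‖Y - X‖ ^ 2 + 2 * γ * frobInner (Y - X) Z +
      (9 / 4 + 2 / 3) * (γ * ‖Z‖) ^ 2 := by
    have e2 : Y - X' = (Y - X) - (X' - X) := by abel
    have h3 : frobInner (Y - X) (X' - X) = frobInner (Y - X) ε - γ * frobInner (Y - X) Z := by
      rw [e1, frobInner_sub_right, frobInner_smul_right]
    have h4 : -frobInner (Y - X) ε ≤ 2 / 3 * ((γ * ‖Z‖) ^ 2 / 2) := by
      have := (abs_le.1 (abs_frobInner_le (Y - X) ε)).1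
      have := mul_le_mul he1 hε' (norm_nonneg _) (by norm_num)
      linarith
    have h5 : ‖X' - X‖ ^ 2 ≤ (3 / 2 * (γ * ‖Z‖)) ^ 2 := by gcongr
    rw [e2, norm_sub_sq_frob, h3]
    linarith
  -- Both Gram matrices are the identity, which has no part across blocks, so the change of metric
  -- enters only through (X' - X)ᵀY.
  have hO : offBlock c (X'ᵀ * (Y - X')) =
      offBlock c (Xᵀ * (Y - X)) + offBlock c ((X' - X)ᵀ * Y) := by
    rw [offBlock_transpose_mul_sub hX', offBlock_transpose_mul_sub hX, ← offBlock_add,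
      ← Matrix.add_mul, ← Matrix.transpose_add, add_sub_cancel]
  set G := offBlock c (Xᵀ * (Y - X)) with hG
  have hGE : ‖G‖ ≤ ‖Y - X‖ := (norm_offBlock_le c _).trans (norm_transpose_mul_le hX _)
  have hlin : frobInner G (offBlock c ((X' - X)ᵀ * Y)) ≤
      -(γ * frobInner G (Zᵀ * Y)) + ‖Y - X‖ * ((γ * ‖Z‖) ^ 2 / 2) := by
    rw [hG, frobInner_offBlock, ← hG, e1, Matrix.transpose_sub, Matrix.sub_mul,
      Matrix.transpose_smul, Matrix.smul_mul, frobInner_sub_right, frobInner_smul_right]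
    have h3 := frobInner_le G (εᵀ * Y)
    have h4 := mul_le_mul hGE ((norm_transpose_mul_le' hY ε).trans hε') (norm_nonneg _) hE0
    linarith
  set o := ‖offBlock c (Xᵀ * Z)‖
  set z := γ * ‖Z‖
  set e := ‖Y - X‖
  have hsq : ‖offBlock c ((X' - X)ᵀ * Y)‖ ^ 2 ≤
      3 * ((γ * o) ^ 2 + (z ^ 2 / 2) ^ 2 + (3 / 2 * z * e) ^ 2) := by
    have h3 : ‖offBlock c ((X' - X)ᵀ * Y)‖ ^ 2 ≤ (γ * o + z ^ 2 / 2 + 3 / 2 * z * e) ^ 2 := by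
      gcongr
    nlinarith [sq_nonneg (γ * o - z ^ 2 / 2), sq_nonneg (γ * o - 3 / 2 * z * e),
      sq_nonneg (z ^ 2 / 2 - 3 / 2 * z * e)]
  have hoffsum : ((ℓ : ℝ) - 2) * ‖offBlock c (X'ᵀ * (Y - X'))‖ ^ 2 ≤
      ((ℓ : ℝ) - 2) * ‖G‖ ^ 2 - 2 * γ * ((ℓ : ℝ) - 2) * frobInner G (Zᵀ * Y) + z ^ 2 +
        3 * ((ℓ : ℝ) - 2) * γ ^ 2 * o ^ 2 + 3 / 4 * ((ℓ : ℝ) - 2) * z ^ 4 + 9 / 8 * z ^ 2 := by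
    rw [hO, norm_add_sq_frob]
    have h3 := mul_le_mul_of_nonneg_left hlin h2
    have h4 := mul_le_mul_of_nonneg_left hsq h2
    have h5 := mul_le_mul_of_nonneg_right he2 (sq_nonneg z)
    have h6 := mul_le_mul_of_nonneg_right he3 (sq_nonneg z)
    linarith
  have hz4 : ((ℓ : ℝ) - 2) * z ^ 4 ≤ ((ℓ : ℝ) - 2) * (γ ^ 4 * L ^ 2 * ‖Z‖ ^ 2) := by
    refine mul_le_mul_of_nonneg_left ?_ h2
    have : z ^ 4 = γ ^ 4 * ‖Z‖ ^ 2 * ‖Z‖ ^ 2 := by simp only [z]; ring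
    rw [this]
    gcongr
  have hz2 : z ^ 2 = γ ^ 2 * ‖Z‖ ^ 2 := mul_pow _ _ _
  rw [blockQuad, blockQuad, linGain, quadGain, ← hG]
  linarith [sq_nonneg z]

theorem offBlock_colMask_mul_mul (c : Fin p → Fin ℓ) (S : Finset (Fin p))
    (G : Matrix (Fin p) (Fin p) ℝ) :
    offBlock c (colMask S * G * colMask S) = colMask S * offBlock c G * colMask S := by
  ext a b
  simp only [offBlock_apply, mul_colMask_apply, colMask_mul_apply]
  by_cases h1 : c a = c b <;> by_cases h2 : a ∈ S <;> by_cases h3 : b ∈ S <;> simp [h1, h2, h3]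

theorem norm_sq_colMask_mul_mul (S : Finset (Fin p)) (G : Matrix (Fin p) (Fin p) ℝ) :
    ‖colMask S * G * colMask S‖ ^ 2 = frobInner (colMask S * G * colMask S) G := by
  rw [← frobInner_self, frobInner_eq_sum, frobInner_eq_sum]
  refine Finset.sum_congr rfl fun a _ => Finset.sum_congr rfl fun b _ => ?_
  simp only [mul_colMask_apply, colMask_mul_apply]
  by_cases h2 : a ∈ S <;> by_cases h3 : b ∈ S <;> simp [h2, h3]

variable {C : Fin ℓ → Finset (Fin p)}

theorem sum_norm_sq_blockOp (hc : ∀ i a, a ∈ C i ↔ c a = i) (hX : Xᵀ * X = 1)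
    (ζ : Matrix (Fin n) (Fin p) ℝ) :
    ∑ s : BlockPair ℓ, ‖blockOp X (pairCols C s) ζ‖ ^ 2 =
      ((ℓ : ℝ) - 1) * ‖ζ‖ ^ 2 - ((ℓ : ℝ) - 2) * ‖offBlock c (Xᵀ * ζ)‖ ^ 2 := by
  simp only [norm_sq_blockOp hX]
  rw [← frobInner_sum_left, sum_blockOp hc, frobInner_sub_left, frobInner_smul_left,
    frobInner_smul_left, frobInner_mul_left, ← frobInner_offBlock, frobInner_self, frobInner_self]

/-- Each entry across two blocks is retained by exactly one pair. -/
theorem sum_norm_sq_offBlock (hc : ∀ i a, a ∈ C i ↔ c a = i) (hX : Xᵀ * X = 1)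
    (ζ : Matrix (Fin n) (Fin p) ℝ) :
    ∑ s : BlockPair ℓ, ‖offBlock c (Xᵀ * blockOp X (pairCols C s) ζ)‖ ^ 2 =
      ‖offBlock c (Xᵀ * ζ)‖ ^ 2 := by
  simp only [transpose_mul_blockOp hX, offBlock_colMask_mul_mul, norm_sq_colMask_mul_mul]
  rw [← frobInner_sum_left, sum_colMask_mul_mul hc, offBlock_offBlock, frobInner_sub_left,
    frobInner_smul_left, frobInner_smul_left, frobInner_self]
  ring

/-- The 9 is 6 from the squared norms plus 3 from the block terms, where ℓ-2 ≤ ℓ-1 is used. -/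
theorem sum_quadGain_le (hc : ∀ i a, a ∈ C i ↔ c a = i) (hℓ : 2 ≤ ℓ) (hX : Xᵀ * X = 1)
    (hζ : ‖ζ‖ ≤ L) :
    ∑ s : BlockPair ℓ, quadGain c γ L X (blockOp X (pairCols C s) ζ) ≤
      ((ℓ : ℝ) - 1) * (9 * γ ^ 2 * L ^ 2 + 3 / 4 * ((ℓ : ℝ) - 2) * γ ^ 4 * L ^ 4) := by
  have h2 : (0 : ℝ) ≤ ℓ - 2 := sub_nonneg.2 (by exact_mod_cast hℓ)
  simp only [quadGain, Finset.sum_add_distrib, ← Finset.mul_sum, sum_norm_sq_blockOp hc hX,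
    sum_norm_sq_offBlock hc hX]
  have h3 : ‖ζ‖ ^ 2 ≤ L ^ 2 := by gcongr
  have h4 : ‖offBlock c (Xᵀ * ζ)‖ ^ 2 ≤ ‖ζ‖ ^ 2 := by
    gcongr
    exact (norm_offBlock_le c _).trans (norm_transpose_mul_le hX ζ)
  set o := ‖offBlock c (Xᵀ * ζ)‖ ^ 2
  have ho : 0 ≤ o := sq_nonneg _
  have hA : 0 ≤ 6 * γ ^ 2 + 3 / 4 * ((ℓ : ℝ) - 2) * γ ^ 4 * L ^ 2 := by positivity
  have h5 : (6 * γ ^ 2 + 3 / 4 * ((ℓ : ℝ) - 2) * γ ^ 4 * L ^ 2) *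
      (((ℓ : ℝ) - 1) * ‖ζ‖ ^ 2 - ((ℓ : ℝ) - 2) * o) ≤
      (6 * γ ^ 2 + 3 / 4 * ((ℓ : ℝ) - 2) * γ ^ 4 * L ^ 2) * (((ℓ : ℝ) - 1) * L ^ 2) := by
    refine mul_le_mul_of_nonneg_left ?_ hA
    have := mul_nonneg h2 ho
    nlinarith
  have h6 : 3 * ((ℓ : ℝ) - 2) * γ ^ 2 * o ≤ 3 * ((ℓ : ℝ) - 1) * γ ^ 2 * L ^ 2 := by
    have : o ≤ L ^ 2 := h4.trans h3
    have h1 : (0 : ℝ) ≤ ℓ - 1 := by linarith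
    gcongr
    linarith
  linarith

theorem norm_sum_blockOp_le (hc : ∀ i a, a ∈ C i ↔ c a = i) (hℓ : 2 ≤ ℓ) (hX : Xᵀ * X = 1)
    (ζ : Matrix (Fin n) (Fin p) ℝ) :
    ‖∑ s : BlockPair ℓ, blockOp X (pairCols C s) ζ‖ ≤ ((ℓ : ℝ) - 1) * ‖ζ‖ := by
  have h2 : (0 : ℝ) ≤ ℓ - 2 := sub_nonneg.2 (by exact_mod_cast hℓ)
  have h1 : (0 : ℝ) ≤ ℓ - 1 := by linarith
  refine (pow_le_pow_iff_left₀ (norm_nonneg _) (by positivity) two_ne_zero).1 ?_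
  rw [sum_blockOp hc, norm_sub_sq_frob, frobInner_smul_left, frobInner_smul_right,
    frobInner_comm ζ, frobInner_mul_left, ← frobInner_offBlock, frobInner_self, norm_smul, norm_smul,
    norm_mul_of_stiefel hX, Real.norm_of_nonneg h2, Real.norm_of_nonneg h1]
  have := mul_nonneg (mul_nonneg h2 (by linarith : (0 : ℝ) ≤ ℓ))
    (sq_nonneg ‖offBlock c (Xᵀ * ζ)‖)
  linarith

/-- With G the off-block part of Xᵀ(Y - X) and K = Xᵀζ, the displacement contributes -(ℓ-2)⟨G, K⟩
and the change of metric +(ℓ-2)⟨G, K⟩. This cancellation is the reason for the adaptive metric; only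
a term quadratic in Y - X is left. -/
theorem sum_linGain_le (hc : ∀ i a, a ∈ C i ↔ c a = i) (hℓ : 2 ≤ ℓ) (hX : Xᵀ * X = 1)
    (hγ : 0 ≤ γ) (hζt : (Xᵀ * ζ)ᵀ = -(Xᵀ * ζ)) (hζ : ‖ζ‖ ≤ L) :
    ∑ s : BlockPair ℓ, linGain c γ X Y (blockOp X (pairCols C s) ζ) ≤
      2 * γ * ((ℓ : ℝ) - 1) *
        (frobInner ζ (Y - X) + ((ℓ : ℝ) - 2) * L * ‖Y - X‖ ^ 2) := by
  have h2 : (0 : ℝ) ≤ ℓ - 2 := sub_nonneg.2 (by exact_mod_cast hℓ)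
  have h1 : (0 : ℝ) ≤ ℓ - 1 := by linarith
  have hsum : ∑ s : BlockPair ℓ, linGain c γ X Y (blockOp X (pairCols C s) ζ) =
      linGain c γ X Y (∑ s : BlockPair ℓ, blockOp X (pairCols C s) ζ) := by
    simp only [linGain, Finset.sum_sub_distrib, ← Finset.mul_sum, Matrix.transpose_sum,
      Matrix.sum_mul, frobInner_comm (Y - X), frobInner_comm (offBlock c _), frobInner_sum_left]
  have hM := norm_sum_blockOp_le hc hℓ hX ζ
  have hMeq := sum_blockOp hc X ζ
  set M := ∑ s : BlockPair ℓ, blockOp X (pairCols C s) ζ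
  set K := Xᵀ * ζ with hK
  set E := Y - X with hE
  set G := offBlock c (Xᵀ * E) with hG
  have hGK : frobInner (Xᵀ * E) (offBlock c K) = frobInner G K := by
    rw [hG, frobInner_offBlock_left]
  have h3 : frobInner E M = ((ℓ : ℝ) - 1) * frobInner ζ E - ((ℓ : ℝ) - 2) * frobInner G K := by
    rw [hMeq, frobInner_sub_right, frobInner_smul_right, frobInner_smul_right, frobInner_comm E,
      frobInner_comm E, frobInner_mul_left, frobInner_comm (offBlock c K), hGK]
  have h4 : Mᵀ * X = -(((ℓ : ℝ) - 1) • K) + ((ℓ : ℝ) - 2) • offBlock c K := by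
    have h5 : Mᵀ * X = (Xᵀ * M)ᵀ := by simp
    have h6 : Xᵀ * M = ((ℓ : ℝ) - 1) • K - ((ℓ : ℝ) - 2) • offBlock c K := by
      rw [hMeq, Matrix.mul_sub, Matrix.mul_smul, Matrix.mul_smul, ← Matrix.mul_assoc Xᵀ X, hX,
        Matrix.one_mul]
    rw [h5, h6, Matrix.transpose_sub, Matrix.transpose_smul, Matrix.transpose_smul,
      transpose_offBlock, hζt, offBlock_neg]
    module
  -- Antisymmetry of K fixes the sign; on G, supported across blocks, the weights combine to -(ℓ-1)
  -- + (ℓ-2) = -1.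
  have h5 : frobInner G (Mᵀ * Y) = frobInner G (Mᵀ * E) - frobInner G K := by
    have h6 : Mᵀ * Y = Mᵀ * E + Mᵀ * X := by rw [hE, Matrix.mul_sub, sub_add_cancel]
    have h7 : frobInner G (offBlock c K) = frobInner G K := by
      rw [hG, frobInner_offBlock]
    rw [h6, frobInner_add_right, h4, frobInner_add_right, frobInner_neg_right,
      frobInner_smul_right, frobInner_smul_right, h7]
    ring
  have h6 : -frobInner G (Mᵀ * E) ≤ ((ℓ : ℝ) - 1) * L * ‖E‖ ^ 2 := by
    have h7 := (abs_le.1 (abs_frobInner_le G (Mᵀ * E))).1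
    have h8 : ‖G‖ ≤ ‖E‖ := (norm_offBlock_le c _).trans (norm_transpose_mul_le hX _)
    have h9 : ‖Mᵀ * E‖ ≤ ((ℓ : ℝ) - 1) * L * ‖E‖ := by
      refine (Matrix.frobenius_norm_mul _ _).trans ?_
      rw [Matrix.frobenius_norm_transpose]
      gcongr
      exact hM.trans (by gcongr)
    have h10 := mul_le_mul h8 h9 (norm_nonneg _) (norm_nonneg _)
    linarith
  rw [hsum, linGain, ← hE, ← hG, h3, h5]
  have h7 := mul_le_mul_of_nonneg_left h6 (mul_nonneg hγ h2)
  linarith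

end Descent

/-- The preimage of a closed set is the projection of a compact part of the graph. -/
theorem continuous_of_isClosed_graph {α β : Type*} [TopologicalSpace α] [TopologicalSpace β]
    [CompactSpace α] [CompactSpace β] [T2Space α] {g : α → β}
    (h : IsClosed {q : α × β | q.2 = g q.1}) : Continuous g := by
  refine continuous_iff_isClosed.2 fun K hK => ?_
  have h1 : g ⁻¹' K = Prod.fst '' ({q : α × β | q.2 = g q.1} ∩ Prod.snd ⁻¹' K) := by
    ext x
    constructor
    · intro hx
      exact ⟨(x, g x), ⟨rfl, hx⟩, rfl⟩
    · rintro ⟨⟨a, b⟩, ⟨h2, h3⟩, rfl⟩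
      change b = g a at h2
      change g a ∈ K
      rw [← h2]; exact h3
  rw [h1]
  exact ((h.inter (hK.preimage continuous_snd)).isCompact.image continuous_fst).isClosed

/-! ### Existence, uniqueness and continuity of the proximal point -/

section Prox

variable {n p ℓ : ℕ}

theorem isCompact_stiefel (m ι : Type*) [Fintype m] [Fintype ι] [DecidableEq ι] :
    IsCompact (Stiefel m ι) := by
  refine Metric.isCompact_of_isClosed_isBounded ?_ ?_
  · have h : Continuous fun X : Matrix m ι ℝ => Xᵀ * X := by fun_prop
    exact isClosed_singleton.preimage h
  · refine (Metric.isBounded_closedBall (x := (0 : Matrix m ι ℝ))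
      (r := Fintype.card ι + 1)).subset fun X hX => ?_
    rw [mem_closedBall_zero_iff]
    have := norm_sq_of_stiefel (X := X) hX
    nlinarith [norm_nonneg X]

instance compactSpace_stiefel (m ι : Type*) [Fintype m] [Fintype ι] [DecidableEq ι] :
    CompactSpace (Stiefel m ι) :=
  isCompact_iff_compactSpace.1 (isCompact_stiefel m ι)

theorem continuous_blockQuad_sub (c : Fin p → Fin ℓ) :
    Continuous fun q : Matrix (Fin n) (Fin p) ℝ × Matrix (Fin n) (Fin p) ℝ =>
      blockQuad c q.1 (q.2 - q.1) := by
  have h := continuous_offBlock c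
  unfold blockQuad
  fun_prop

/-- The standing assumptions on the objective function, the partition and the parameter. -/
structure ProxSetting (C : Fin ℓ → Finset (Fin p)) (c : Fin p → Fin ℓ)
    (f : Matrix (Fin n) (Fin p) ℝ → ℝ) (U : Set (Matrix (Fin n) (Fin p) ℝ)) (τ L lam : ℝ) :
    Prop where
  two_le : 2 ≤ ℓ
  mem_block : ∀ i a, a ∈ C i ↔ c a = i
  nhds : ∀ X ∈ Stiefel (Fin n) (Fin p), U ∈ 𝓝 X
  tau_nonneg : 0 ≤ τ
  weaklyConvex : WeaklyConvexOn τ U f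
  lip_pos : 0 < L
  lipschitz : ∀ X ∈ U, ∀ Y ∈ U, |f X - f Y| ≤ L * ‖X - Y‖
  lam_pos : 0 < lam
  lam_lt : lam < ℓ / (2 * (τ + (2 * ℓ - 1) * L))

variable {C : Fin ℓ → Finset (Fin p)} {c : Fin p → Fin ℓ} {f : Matrix (Fin n) (Fin p) ℝ → ℝ}
  {U : Set (Matrix (Fin n) (Fin p) ℝ)} {τ L lam : ℝ} {X Y Z : Matrix (Fin n) (Fin p) ℝ}

namespace ProxSetting

theorem two_le_cast (h : ProxSetting C c f U τ L lam) : (2 : ℝ) ≤ ℓ := by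
  exact_mod_cast h.two_le

theorem modulus_pos (h : ProxSetting C c f U τ L lam) :
    τ + (2 * ℓ - 1) * L < ℓ / (2 * lam) := by
  have h2 := h.two_le_cast
  have h3 : 0 < τ + (2 * ℓ - 1) * L :=
    add_pos_of_nonneg_of_pos h.tau_nonneg (mul_pos (by linarith) h.lip_pos)
  have h4 := h.lam_lt
  have h5 := h.lam_pos
  rw [lt_div_iff₀ (by positivity)] at h4 ⊢
  linarith

theorem stiefel_subset (h : ProxSetting C c f U τ L lam) : Stiefel (Fin n) (Fin p) ⊆ U :=
  fun X hX => mem_of_mem_nhds (h.nhds X hX)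

theorem continuousOn (h : ProxSetting C c f U τ L lam) :
    ContinuousOn f (Stiefel (Fin n) (Fin p)) := fun X hX =>
  (continuousAt_of_lipschitz_nhds (h.nhds X hX) h.lipschitz).continuousWithinAt

theorem proxObjective_eq (h : ProxSetting C c f U τ L lam) (hX : X ∈ Stiefel (Fin n) (Fin p))
    (Y : Matrix (Fin n) (Fin p) ℝ) :
    proxObjective C f lam X Y = blockObjective c f lam X Y :=
  RSSM.proxObjective_eq h.mem_block h.two_le hX f lam Y

theorem mem_proxSet_iff (h : ProxSetting C c f U τ L lam) (hX : X ∈ Stiefel (Fin n) (Fin p)) :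
    Y ∈ proxSet C f lam X ↔ Y ∈ Stiefel (Fin n) (Fin p) ∧
      ∀ Z ∈ Stiefel (Fin n) (Fin p), blockObjective c f lam X Y ≤ blockObjective c f lam X Z := by
  simp only [proxSet, Set.mem_ofPred_eq, h.proxObjective_eq hX]

theorem continuous_blockObjective (h : ProxSetting C c f U τ L lam) :
    Continuous fun q : Stiefel (Fin n) (Fin p) × Stiefel (Fin n) (Fin p) =>
      blockObjective c f lam q.1 q.2 := by
  have h1 : Continuous fun Y : Stiefel (Fin n) (Fin p) => f Y :=
    continuousOn_iff_continuous_domRestrict.1 h.continuousOn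
  have h2 : Continuous fun q : Stiefel (Fin n) (Fin p) × Stiefel (Fin n) (Fin p) =>
      blockQuad c (q.1 : Matrix (Fin n) (Fin p) ℝ) (q.2 - q.1) :=
    (continuous_blockQuad_sub c).comp
      (f := fun q : Stiefel (Fin n) (Fin p) × Stiefel (Fin n) (Fin p) =>
        ((q.1 : Matrix (Fin n) (Fin p) ℝ), (q.2 : Matrix (Fin n) (Fin p) ℝ))) (by fun_prop)
  exact (h1.comp continuous_snd).add (h2.const_mul _)

theorem proxSet_nonempty (h : ProxSetting C c f U τ L lam) (hX : X ∈ Stiefel (Fin n) (Fin p)) :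
    (proxSet C f lam X).Nonempty := by
  have hc : Continuous fun Y : Stiefel (Fin n) (Fin p) => blockObjective c f lam X Y :=
    h.continuous_blockObjective.comp (f := fun Y => ((⟨X, hX⟩ : Stiefel (Fin n) (Fin p)), Y))
      (by fun_prop)
  obtain ⟨Y, -, hY⟩ := isCompact_univ.exists_isMinOn ⟨⟨X, hX⟩, Set.mem_univ _⟩ hc.continuousOn
  exact ⟨Y, (h.mem_proxSet_iff hX).2 ⟨Y.2, fun Z hZ => hY (Set.mem_univ (⟨Z, hZ⟩ : Stiefel _ _))⟩⟩

theorem prox_mem (h : ProxSetting C c f U τ L lam) (hX : X ∈ Stiefel (Fin n) (Fin p)) :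
    prox C f lam X ∈ proxSet C f lam X :=
  Classical.epsilon_spec (h.proxSet_nonempty hX)

theorem prox_mem_stiefel (h : ProxSetting C c f U τ L lam) (hX : X ∈ Stiefel (Fin n) (Fin p)) :
    prox C f lam X ∈ Stiefel (Fin n) (Fin p) :=
  (h.prox_mem hX).1

theorem growth (h : ProxSetting C c f U τ L lam) (hX : X ∈ Stiefel (Fin n) (Fin p))
    (hY : Y ∈ proxSet C f lam X) (hZ : Z ∈ Stiefel (Fin n) (Fin p)) :
    blockObjective c f lam X Y + (ℓ / (2 * lam) - τ - (2 * ℓ - 1) * L) / 2 * ‖Z - Y‖ ^ 2 ≤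
      blockObjective c f lam X Z := by
  rw [h.mem_proxSet_iff hX] at hY
  exact blockObjective_growth h.two_le h.lam_pos h.lip_pos.le h.weaklyConvex h.lipschitz
    h.stiefel_subset hX hY.1 hZ hY.2

/-- The upper bound on λ is exactly positivity of the growth modulus, which forces two minimizers to
agree. -/
theorem eq_of_mem_proxSet (h : ProxSetting C c f U τ L lam) (hX : X ∈ Stiefel (Fin n) (Fin p))
    (hY : Y ∈ proxSet C f lam X) (hZ : Z ∈ proxSet C f lam X) : Z = Y := by
  have h1 := h.growth hX hY hZ.1
  have h2 := ((h.mem_proxSet_iff hX).1 hZ).2 Y hY.1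
  have h3 := h.modulus_pos
  have h4 : ‖Z - Y‖ = 0 := by
    by_contra hne
    have : 0 < ‖Z - Y‖ ^ 2 := by positivity
    nlinarith
  exact sub_eq_zero.1 (norm_eq_zero.1 h4)

theorem proxSet_eq_singleton (h : ProxSetting C c f U τ L lam)
    (hX : X ∈ Stiefel (Fin n) (Fin p)) : proxSet C f lam X = {prox C f lam X} :=
  Set.eq_singleton_iff_unique_mem.2
    ⟨h.prox_mem hX, fun _ hZ => h.eq_of_mem_proxSet hX (h.prox_mem hX) hZ⟩

theorem isLeast_envelope (h : ProxSetting C c f U τ L lam) (hX : X ∈ Stiefel (Fin n) (Fin p)) :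
    IsLeast (proxObjective C f lam X '' Stiefel (Fin n) (Fin p))
      (proxObjective C f lam X (prox C f lam X)) := by
  refine ⟨⟨_, h.prox_mem_stiefel hX, rfl⟩, ?_⟩
  rintro _ ⟨Z, hZ, rfl⟩
  exact (h.prox_mem hX).2 Z hZ

theorem envelope_eq (h : ProxSetting C c f U τ L lam) (hX : X ∈ Stiefel (Fin n) (Fin p)) :
    envelope C f lam X = blockObjective c f lam X (prox C f lam X) := by
  rw [envelope, (h.isLeast_envelope hX).csInf_eq, h.proxObjective_eq hX]

theorem envelope_le (h : ProxSetting C c f U τ L lam) (hX : X ∈ Stiefel (Fin n) (Fin p))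
    (hY : Y ∈ Stiefel (Fin n) (Fin p)) : envelope C f lam X ≤ blockObjective c f lam X Y := by
  rw [h.envelope_eq hX]
  exact ((h.mem_proxSet_iff hX).1 (h.prox_mem hX)).2 Y hY

theorem continuous_prox (h : ProxSetting C c f U τ L lam) :
    Continuous fun X : Stiefel (Fin n) (Fin p) => prox C f lam X := by
  let g : Stiefel (Fin n) (Fin p) → Stiefel (Fin n) (Fin p) := fun X =>
    ⟨prox C f lam X, h.prox_mem_stiefel X.2⟩
  have hg : Continuous g := by
    refine continuous_of_isClosed_graph ?_
    -- Because minimizers are unique, the graph is cut out by the closed minimality inequalities.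
    have h1 : {q : Stiefel (Fin n) (Fin p) × Stiefel (Fin n) (Fin p) | q.2 = g q.1} =
        ⋂ Z : Stiefel (Fin n) (Fin p),
          {q | blockObjective c f lam q.1 q.2 ≤ blockObjective c f lam q.1 Z} := by
      ext ⟨X, Y⟩
      simp only [Set.mem_ofPred_eq, Set.mem_iInter]
      constructor
      · rintro rfl Z
        exact ((h.mem_proxSet_iff X.2).1 (h.prox_mem X.2)).2 Z Z.2
      · intro hY
        exact Subtype.ext (h.eq_of_mem_proxSet X.2 (h.prox_mem X.2)
          ((h.mem_proxSet_iff X.2).2 ⟨Y.2, fun Z hZ => hY ⟨Z, hZ⟩⟩))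
    rw [h1]
    refine isClosed_iInter fun Z => isClosed_le h.continuous_blockObjective ?_
    exact h.continuous_blockObjective.comp
      (f := fun q : Stiefel (Fin n) (Fin p) × Stiefel (Fin n) (Fin p) => (q.1, Z)) (by fun_prop)
  exact continuous_subtype_val.comp hg

theorem continuous_envelope (h : ProxSetting C c f U τ L lam) :
    Continuous fun X : Stiefel (Fin n) (Fin p) => envelope C f lam X := by
  have h1 : (fun X : Stiefel (Fin n) (Fin p) => envelope C f lam X) =
      fun X : Stiefel (Fin n) (Fin p) => blockObjective c f lam X (prox C f lam X) :=
    funext fun X => h.envelope_eq X.2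
  rw [h1]
  exact h.continuous_blockObjective.comp
    (f := fun X : Stiefel (Fin n) (Fin p) =>
      (X, (⟨prox C f lam X, h.prox_mem_stiefel X.2⟩ : Stiefel (Fin n) (Fin p))))
    (continuous_id.prodMk (h.continuous_prox.subtype_mk _))

/-- The bound ‖Y - X‖ ≤ 4λL/ℓ combined with the upper bound on λ; this smallness absorbs the factors
ℓ-2 in the one-step estimate. -/
theorem norm_prox_sub_le (h : ProxSetting C c f U τ L lam) (hX : X ∈ Stiefel (Fin n) (Fin p)) :
    (2 * (ℓ : ℝ) - 1) * ‖prox C f lam X - X‖ ≤ 2 := by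
  have h1 := norm_sub_le_of_minimizer (c := c) h.two_le h.lam_pos (h.stiefel_subset hX)
    (h.stiefel_subset (h.prox_mem_stiefel hX)) h.lip_pos.le h.lipschitz
    (((h.mem_proxSet_iff hX).1 (h.prox_mem hX)).2 X hX)
  have h2 := h.two_le_cast
  have h3 := h.modulus_pos
  have h4 := h.lam_pos
  rw [le_div_iff₀ (by positivity)] at h1
  rw [lt_div_iff₀ (by positivity)] at h3
  have h5 := mul_nonneg h.tau_nonneg h4.le
  have h6 : (2 * (ℓ : ℝ) - 1) * (‖prox C f lam X - X‖ * ℓ) ≤ (2 * ℓ - 1) * (4 * lam * L) :=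
    mul_le_mul_of_nonneg_left h1 (by linarith)
  have h7 : ((2 * (ℓ : ℝ) - 1) * ‖prox C f lam X - X‖) * ℓ ≤ 2 * ℓ := by linarith
  exact le_of_mul_le_mul_right h7 (by linarith)

end ProxSetting

end Prox

/-! ### One-step descent of the envelope and its average -/

section OneStep

variable {n p ℓ : ℕ} {C : Fin ℓ → Finset (Fin p)} {c : Fin p → Fin ℓ}
  {f : Matrix (Fin n) (Fin p) ℝ → ℝ} {U : Set (Matrix (Fin n) (Fin p) ℝ)} {τ L lam γ : ℝ}
  {X X' ξ : Matrix (Fin n) (Fin p) ℝ} {s : BlockPair ℓ}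

/-- A bound for the change of the squared distance from `Y` when one step from `X` with Euclidean
subgradient `ξ` updates the columns in `S`. -/
def stepGain (c : Fin p → Fin ℓ) (γ L : ℝ) (S : Finset (Fin p))
    (X Y ξ : Matrix (Fin n) (Fin p) ℝ) : ℝ :=
  linGain c γ X Y (blockOp X S (tangentPart X ξ)) +
    quadGain c γ L X (blockOp X S (tangentPart X ξ))

theorem continuous_frobInner {α m ι : Type*} [TopologicalSpace α] [Fintype m] [Fintype ι]
    {A B : α → Matrix m ι ℝ} (hA : Continuous A) (hB : Continuous B) :
    Continuous fun x => frobInner (A x) (B x) :=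
  (hA.matrix_transpose.matrix_mul hB).matrix_trace

theorem continuous_stepGain (c : Fin p → Fin ℓ) (γ L : ℝ) (S : Finset (Fin p)) :
    Continuous fun q : Matrix (Fin n) (Fin p) ℝ × Matrix (Fin n) (Fin p) ℝ ×
      Matrix (Fin n) (Fin p) ℝ => stepGain c γ L S q.1 q.2.1 q.2.2 := by
  have hZ : Continuous fun q : Matrix (Fin n) (Fin p) ℝ × Matrix (Fin n) (Fin p) ℝ ×
      Matrix (Fin n) (Fin p) ℝ => blockOp q.1 S (tangentPart q.1 q.2.2) := by
    simp only [blockOp_apply_eq, tangentPart]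
    fun_prop
  have hY : Continuous fun q : Matrix (Fin n) (Fin p) ℝ × Matrix (Fin n) (Fin p) ℝ ×
      Matrix (Fin n) (Fin p) ℝ => q.2.1 := by fun_prop
  have hX : Continuous fun q : Matrix (Fin n) (Fin p) ℝ × Matrix (Fin n) (Fin p) ℝ ×
      Matrix (Fin n) (Fin p) ℝ => q.1 := by fun_prop
  have hO := continuous_offBlock c
  unfold stepGain linGain quadGain
  refine .add (.sub (.mul continuous_const ?_) (.mul continuous_const ?_))
    (.add (.mul continuous_const (hZ.norm.pow 2)) (.mul continuous_const (.pow (.norm ?_) 2)))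
  · exact continuous_frobInner (hY.sub hX) hZ
  · exact continuous_frobInner (hO.comp (hX.matrix_transpose.matrix_mul (hY.sub hX)))
      (hZ.matrix_transpose.matrix_mul hY)
  · exact hO.comp (hX.matrix_transpose.matrix_mul hZ)

/-- The old proximal point is an admissible competitor at `X'`, so its value of f cancels and only
the adaptive distance changes. -/
theorem ProxSetting.envelope_step_le (h : ProxSetting C c f U τ L lam)
    (hX : X ∈ Stiefel (Fin n) (Fin p)) (hξ : ξ ∈ clarkeSubdiff f X) (hγ : 0 ≤ γ)
    (hγL : γ * L ≤ 1) (hs : IsStep C γ X ξ s X') :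
    envelope C f lam X' ≤ envelope C f lam X +
      ℓ / (4 * lam) * stepGain c γ L (pairCols C s) X (prox C f lam X) ξ := by
  have hX' := hs.mem_stiefel hX
  have hY := h.prox_mem_stiefel hX
  have h0 : (0 : ℝ) ≤ ℓ / (4 * lam) := by have := h.lam_pos; positivity
  have hξL := norm_le_of_mem_clarkeSubdiff h.lip_pos.le (h.nhds X hX) h.lipschitz hξ
  have hZL : ‖blockOp X (pairCols C s) (tangentPart X ξ)‖ ≤ L := by
    refine le_trans ?_ ((norm_tangentPart_le hX ξ).trans hξL)
    have h1 := norm_sq_blockOp hX (tangentPart X ξ) (pairCols C s)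
    have h2 := frobInner_le (blockOp X (pairCols C s) (tangentPart X ξ)) (tangentPart X ξ)
    by_contra! h3
    nlinarith [norm_nonneg (tangentPart X ξ)]
  have h1 := blockQuad_step_le (c := c) h.two_le hX hX' hY hγ hγL hZL (hs.norm_sub_le hX)
    (h.norm_prox_sub_le hX)
  refine (h.envelope_le hX' hY).trans ?_
  rw [h.envelope_eq hX, blockObjective, blockObjective, stepGain]
  have := mul_le_mul_of_nonneg_left h1 h0
  linarith

theorem ProxSetting.avg_stepGain_le (h : ProxSetting C c f U τ L lam)
    (hX : X ∈ Stiefel (Fin n) (Fin p)) (hξ : ξ ∈ clarkeSubdiff f X) (hγ : 0 ≤ γ) :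
    ∑ s : BlockPair ℓ, ((ℓ.choose 2 : ℕ) : ℝ)⁻¹ *
        (ℓ / (4 * lam) * stepGain c γ L (pairCols C s) X (prox C f lam X) ξ) ≤
      9 * γ ^ 2 * L ^ 2 / (2 * lam) + (ℓ - 2) * γ ^ 4 * L ^ 4 / (2 * lam) -
        γ / (2 * lam) * (ℓ / (2 * lam) - (τ + (2 * ℓ - 3) * L)) *
          blockQuad c X (prox C f lam X - X) := by
  have hY := h.prox_mem_stiefel hX
  have h2 := h.two_le_cast
  have hlam := h.lam_pos
  have hL := h.lip_pos
  have hτ := h.tau_nonneg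
  have hm := h.modulus_pos
  have hξL := norm_le_of_mem_clarkeSubdiff hL.le (h.nhds X hX) h.lipschitz hξ
  have hζ := (norm_tangentPart_le hX ξ).trans hξL
  have hq := sum_quadGain_le (γ := γ) h.mem_block h.two_le hX hζ
  have hl := sum_linGain_le (Y := prox C f lam X) h.mem_block h.two_le hX hγ
    (transpose_mul_tangentPart_antisymm hX ξ) hζ
  have hin := frobInner_tangentPart_le hτ hL.le h.weaklyConvex (h.nhds X hX)
    (h.nhds _ hY) h.lipschitz hξ hX hY
  have hgr := h.growth hX (h.prox_mem hX) hX
  rw [blockObjective_self, blockObjective, norm_sub_rev] at hgr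
  have hQ := norm_sq_le_blockQuad h.two_le c X (prox C f lam X - X)
  set Y := prox C f lam X
  set Q := blockQuad c X (Y - X)
  set e := ‖Y - X‖ ^ 2 with he
  have he0 : 0 ≤ e := sq_nonneg _
  -- With a = ℓ/(2λ), growth at Y tested at X gives f(Y) - f(X) ≤ -aQ/2 up to a nonpositive multiple
  -- of e, which is dropped. The errors combine as (τ + L)/2 + (ℓ-2)L = (τ + (2ℓ-3)L)/2, and e ≤ Q.
  have hkey : frobInner (tangentPart X ξ) (Y - X) + ((ℓ : ℝ) - 2) * L * e ≤
      -(1 / 2) * (ℓ / (2 * lam) - (τ + (2 * ℓ - 3) * L)) * Q := by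
    have h3 : ℓ / (4 * lam) = ℓ / (2 * lam) / 2 := by field_simp; ring
    rw [h3] at hgr
    set a := ℓ / (2 * lam)
    have h4 : 0 ≤ (a - τ - (2 * ℓ - 1) * L) * e := mul_nonneg (by linarith) he0
    have h5 : (τ + (2 * ℓ - 3) * L) * e ≤ (τ + (2 * ℓ - 3) * L) * Q := by
      refine mul_le_mul_of_nonneg_left hQ ?_
      have : 0 ≤ (2 * (ℓ : ℝ) - 3) * L := mul_nonneg (by linarith) hL.le
      linarith
    linarith
  have hsum : ∑ s : BlockPair ℓ, stepGain c γ L (pairCols C s) X Y ξ ≤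
      ((ℓ : ℝ) - 1) * (9 * γ ^ 2 * L ^ 2 + 3 / 4 * ((ℓ : ℝ) - 2) * γ ^ 4 * L ^ 4 -
        γ * (ℓ / (2 * lam) - (τ + (2 * ℓ - 3) * L)) * Q) := by
    simp only [stepGain, Finset.sum_add_distrib]
    have h3 := mul_le_mul_of_nonneg_left hkey
      (mul_nonneg hγ (by linarith : (0 : ℝ) ≤ ℓ - 1))
    linarith
  rw [← Finset.mul_sum, ← Finset.mul_sum, cast_choose_two]
  have h1 : (0 : ℝ) < ℓ - 1 := by linarith
  have h0 : (0 : ℝ) < ℓ := by linarith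
  have hc : 0 ≤ ((ℓ : ℝ) * (ℓ - 1) / 2)⁻¹ * (ℓ / (4 * lam)) := by positivity
  have h3 := mul_le_mul_of_nonneg_left hsum hc
  have h4 : ((ℓ : ℝ) * (ℓ - 1) / 2)⁻¹ * (ℓ / (4 * lam)) = 1 / (2 * lam) / (ℓ - 1) := by
    field_simp; ring
  rw [← mul_assoc]
  refine h3.trans ?_
  rw [h4, ← mul_assoc, div_mul_cancel₀ _ h1.ne']
  -- The fourth-order coefficient obtained is 3/4 of the one claimed.
  have h5 : 0 ≤ 1 / 4 * (((ℓ : ℝ) - 2) * γ ^ 4 * L ^ 4 / (2 * lam)) := by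
    have : (0 : ℝ) ≤ ℓ - 2 := by linarith
    positivity
  have h6 : 1 / (2 * lam) * (9 * γ ^ 2 * L ^ 2 + 3 / 4 * ((ℓ : ℝ) - 2) * γ ^ 4 * L ^ 4 -
      γ * (ℓ / (2 * lam) - (τ + (2 * ℓ - 3) * L)) * Q) =
    9 * γ ^ 2 * L ^ 2 / (2 * lam) + 3 / 4 * ((ℓ - 2) * γ ^ 4 * L ^ 4 / (2 * lam)) -
      γ / (2 * lam) * (ℓ / (2 * lam) - (τ + (2 * ℓ - 3) * L)) * Q := by ring
  rw [h6]
  linarith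

end OneStep

/-! ### Conditional expectation of an independent random choice -/

section CondExp

variable {Ω : Type*} {m m₀ : MeasurableSpace Ω} {μ : Measure Ω}

theorem integrable_of_measurable_of_abs_le [IsFiniteMeasure μ] {g : Ω → ℝ} (hg : Measurable g)
    {M : ℝ} (hM : ∀ ω, |g ω| ≤ M) : Integrable g μ :=
  Integrable.of_bound hg.aestronglyMeasurable M (Eventually.of_forall hM)

/-- Conditioning a random choice that is independent of `m` averages over the choice. -/
theorem condExp_sum_indicator_mul {β : Type*} [Fintype β] [MeasurableSpace β]
    [MeasurableSingletonClass β] [IsProbabilityMeasure μ] (hm : m ≤ m₀) {S : Ω → β}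
    (hS : Measurable S) (hind : Indep m (MeasurableSpace.comap S inferInstance) μ)
    {Ψ : β → Ω → ℝ} (hΨ : ∀ s, Measurable[m] (Ψ s)) {M : ℝ} (hM : ∀ s ω, |Ψ s ω| ≤ M) :
    μ[∑ s, Ψ s * (S ⁻¹' {s}).indicator 1 | m] =ᵐ[μ]
      fun ω => ∑ s, Ψ s ω * (μ.map S).real {s} := by
  have hmeas : ∀ s, MeasurableSet (S ⁻¹' {s}) := fun s => hS (measurableSet_singleton s)
  have hiInt : ∀ s, Integrable ((S ⁻¹' {s}).indicator (1 : Ω → ℝ)) μ := fun s =>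
    (integrable_const (1 : ℝ)).indicator (hmeas s)
  have hpInt : ∀ s, Integrable (Ψ s * (S ⁻¹' {s}).indicator (1 : Ω → ℝ)) μ := by
    intro s
    refine integrable_of_measurable_of_abs_le (M := M)
      (((hΨ s).mono hm le_rfl).mul (measurable_one.indicator (hmeas s))) fun ω => ?_
    rw [Pi.mul_apply, abs_mul]
    by_cases h : ω ∈ S ⁻¹' {s}
    · rw [Set.indicator_of_mem h]; simpa using hM s ω
    · rw [Set.indicator_of_notMem h]
      simpa using (abs_nonneg _).trans (hM s ω)
  have h1 : ∀ s, μ[Ψ s * (S ⁻¹' {s}).indicator (1 : Ω → ℝ) | m] =ᵐ[μ]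
      fun ω => Ψ s ω * (μ.map S).real {s} := by
    intro s
    have h2 := condExp_mul_of_stronglyMeasurable_left (hΨ s).stronglyMeasurable (hpInt s) (hiInt s)
    have h3 : μ[(S ⁻¹' {s}).indicator (1 : Ω → ℝ) | m] =ᵐ[μ]
        fun _ => ∫ ω, (S ⁻¹' {s}).indicator (1 : Ω → ℝ) ω ∂μ := by
      refine condExp_indep_eq hS.comap_le hm ?_ hind.symm
      exact stronglyMeasurable_one.indicator ⟨{s}, measurableSet_singleton s, rfl⟩
    filter_upwards [h2, h3] with ω h4 h5
    rw [h4, Pi.mul_apply, h5, integral_indicator_one (hmeas s), map_measureReal_apply hS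
      (measurableSet_singleton s)]
  refine (condExp_finsetSum (fun s _ => hpInt s) m).trans ?_
  have h2 := ae_all_iff.2 h1
  filter_upwards [h2] with ω hω
  rw [Finset.sum_apply]
  exact Finset.sum_congr rfl fun s _ => hω s

end CondExp

instance secondCountableTopology_matrix (m ι : Type*) [Fintype m] [Fintype ι] :
    SecondCountableTopology (Matrix m ι ℝ) :=
  inferInstanceAs (SecondCountableTopology (m → ι → ℝ))

/-! ### Measurability of the envelope and the proximal point -/

section ProxMeasurable

theorem measurable_comp_of_forall_mem {α β δ : Type*} {m : MeasurableSpace α} [MeasurableSpace β]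
    [MeasurableSpace δ] {S : Set β} {g : β → δ} (hg : Measurable fun x : S => g x) {Z : α → β}
    (hZ : Measurable Z) (hZS : ∀ ω, Z ω ∈ S) : Measurable fun ω => g (Z ω) := by
  have h1 : Measurable fun ω => (⟨Z ω, hZS ω⟩ : S) := hZ.subtype_mk
  exact hg.comp h1

variable {n p ℓ : ℕ} {Ω : Type*} {m : MeasurableSpace Ω} {f : Matrix (Fin n) (Fin p) ℝ → ℝ}
  {C : Fin ℓ → Finset (Fin p)} {c : Fin p → Fin ℓ} {U : Set (Matrix (Fin n) (Fin p) ℝ)}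
  {τ L lam : ℝ}

theorem ProxSetting.measurable_envelope_comp (h : ProxSetting C c f U τ L lam)
    {Z : Ω → Matrix (Fin n) (Fin p) ℝ} (hZ : Measurable Z)
    (hZS : ∀ ω, Z ω ∈ Stiefel (Fin n) (Fin p)) : Measurable fun ω => envelope C f lam (Z ω) :=
  measurable_comp_of_forall_mem h.continuous_envelope.measurable hZ hZS

theorem ProxSetting.measurable_prox_comp (h : ProxSetting C c f U τ L lam)
    {Z : Ω → Matrix (Fin n) (Fin p) ℝ} (hZ : Measurable Z)
    (hZS : ∀ ω, Z ω ∈ Stiefel (Fin n) (Fin p)) : Measurable fun ω => prox C f lam (Z ω) :=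
  measurable_comp_of_forall_mem h.continuous_prox.measurable hZ hZS

end ProxMeasurable

/-! ### The conditional descent inequality for the iterates -/

section Iterates

variable {n p ℓ : ℕ} {Ω : Type*} {m₀ : MeasurableSpace Ω} {μ : Measure Ω}
  {f : Matrix (Fin n) (Fin p) ℝ → ℝ} {C : Fin ℓ → Finset (Fin p)} {γ : ℕ → ℝ}
  {X₀ : Matrix (Fin n) (Fin p) ℝ} {X ξ : ℕ → Ω → Matrix (Fin n) (Fin p) ℝ}
  {pr : ℕ → Ω → BlockPair ℓ}

theorem IsIterates.mem_stiefel (hX : IsIterates μ f C γ X₀ X ξ pr)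
    (hX₀ : X₀ ∈ Stiefel (Fin n) (Fin p)) (k : ℕ) (ω : Ω) : X k ω ∈ Stiefel (Fin n) (Fin p) := by
  induction k with
  | zero => rw [hX.init]; exact hX₀
  | succ k ih => exact (hX.step k ω).mem_stiefel ih

theorem IsIterates.past_le (hX : IsIterates μ f C γ X₀ X ξ pr) (k : ℕ) : past X ξ pr k ≤ m₀ :=
  sup_le (iSup₂_le fun j _ =>
      sup_le (hX.measurable_iter j).comap_le (hX.measurable_subgrad j).comap_le)
    (iSup₂_le fun j _ => (hX.measurable_pair j).comap_le)

theorem comap_iter_le_past (X ξ : ℕ → Ω → Matrix (Fin n) (Fin p) ℝ) (pr : ℕ → Ω → BlockPair ℓ)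
    (k : ℕ) : MeasurableSpace.comap (X k) inferInstance ≤ past X ξ pr k :=
  le_sup_of_le_left (le_iSup₂_of_le k le_rfl le_sup_left)

theorem comap_subgrad_le_past (X ξ : ℕ → Ω → Matrix (Fin n) (Fin p) ℝ)
    (pr : ℕ → Ω → BlockPair ℓ) (k : ℕ) :
    MeasurableSpace.comap (ξ k) inferInstance ≤ past X ξ pr k :=
  le_sup_of_le_left (le_iSup₂_of_le k le_rfl le_sup_right)

variable {c : Fin p → Fin ℓ} {U : Set (Matrix (Fin n) (Fin p) ℝ)} {τ L lam : ℝ}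

theorem ProxSetting.exists_abs_envelope_le (h : ProxSetting C c f U τ L lam) :
    ∃ M, ∀ X ∈ Stiefel (Fin n) (Fin p), |envelope C f lam X| ≤ M := by
  obtain ⟨M, hM⟩ := isCompact_univ.exists_bound_of_continuousOn h.continuous_envelope.continuousOn
  exact ⟨M, fun X hX => hM ⟨X, hX⟩ (Set.mem_univ _)⟩

/-- Continuity on a compact set; the Lipschitz constant confines the subgradients to a ball. -/
theorem exists_abs_stepGain_le (C : Fin ℓ → Finset (Fin p)) (c : Fin p → Fin ℓ) (γ L : ℝ) :
    ∃ M, ∀ s : BlockPair ℓ, ∀ X ∈ Stiefel (Fin n) (Fin p), ∀ Y ∈ Stiefel (Fin n) (Fin p),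
      ∀ ξ : Matrix (Fin n) (Fin p) ℝ, ‖ξ‖ ≤ L → |stepGain c γ L (pairCols C s) X Y ξ| ≤ M := by
  have hK := (isCompact_stiefel (Fin n) (Fin p)).prod ((isCompact_stiefel (Fin n) (Fin p)).prod
    (isCompact_closedBall (0 : Matrix (Fin n) (Fin p) ℝ) L))
  choose M hM using fun s : BlockPair ℓ => hK.exists_bound_of_continuousOn
    (continuous_stepGain c γ L (pairCols C s)).continuousOn
  refine ⟨∑ s, |M s|, fun s X hX Y hY ξ hξ => ?_⟩
  have h1 := hM s (X, Y, ξ) ⟨hX, hY, mem_closedBall_zero_iff.2 hξ⟩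
  refine h1.trans ((le_abs_self _).trans ?_)
  exact Finset.single_le_sum (f := fun s => |M s|) (fun _ _ => abs_nonneg _) (Finset.mem_univ s)

theorem IsIterates.integrable_envelope [IsProbabilityMeasure μ]
    (hX : IsIterates μ f C γ X₀ X ξ pr) (h : ProxSetting C c f U τ L lam)
    (hX₀ : X₀ ∈ Stiefel (Fin n) (Fin p)) (k : ℕ) :
    Integrable (fun ω => envelope C f lam (X k ω)) μ := by
  obtain ⟨M, hM⟩ := h.exists_abs_envelope_le
  exact integrable_of_measurable_of_abs_le
    (h.measurable_envelope_comp (hX.measurable_iter k) (hX.mem_stiefel hX₀ k))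
    fun ω => hM _ (hX.mem_stiefel hX₀ k ω)

theorem IsIterates.map_pair_real (hX : IsIterates μ f C γ X₀ X ξ pr) (k : ℕ) (s : BlockPair ℓ) :
    (μ.map (pr k)).real {s} = ((ℓ.choose 2 : ℕ) : ℝ)⁻¹ := by
  rw [hX.uniform, Measure.real, uniformOn_univ, Measure.count_singleton, card_blockPair]
  simp

theorem IsIterates.condExp_envelope_le [IsProbabilityMeasure μ]
    (hX : IsIterates μ f C γ X₀ X ξ pr) (h : ProxSetting C c f U τ L lam)
    (hX₀ : X₀ ∈ Stiefel (Fin n) (Fin p)) (k : ℕ) (hγ : 0 ≤ γ k) (hγL : γ k * L ≤ 1) :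
    μ[fun ω => envelope C f lam (X (k + 1) ω) | MeasurableSpace.comap (X k) inferInstance]
      ≤ᵐ[μ] fun ω => envelope C f lam (X k ω) +
        (9 * γ k ^ 2 * L ^ 2 / (2 * lam) + (ℓ - 2) * γ k ^ 4 * L ^ 4 / (2 * lam) -
          γ k / (2 * lam) * (ℓ / (2 * lam) - (τ + (2 * ℓ - 3) * L)) *
            blockQuad c (X k ω) (prox C f lam (X k ω) - X k ω)) := by
  have hSt := hX.mem_stiefel hX₀
  have hm := hX.past_le k
  have hXm := (hX.measurable_iter k).comap_le
  have hσm := comap_iter_le_past X ξ pr k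
  have hXσ := comap_measurable (m := instMeasurableSpaceMatrix) (X k)
  have hYσ := h.measurable_prox_comp hXσ (hSt k)
  have heσ := h.measurable_envelope_comp hXσ (hSt k)
  have hξm := (comap_measurable (m := instMeasurableSpaceMatrix) (ξ k)).mono (comap_subgrad_le_past X ξ pr k) le_rfl
  have hξL : ∀ ω, ‖ξ k ω‖ ≤ L := fun ω =>
    norm_le_of_mem_clarkeSubdiff h.lip_pos.le (h.nhds _ (hSt k ω)) h.lipschitz (hX.subgrad k ω)
  have hK : (0 : ℝ) ≤ ℓ / (4 * lam) := by have := h.lam_pos; positivity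
  let Ψ : BlockPair ℓ → Ω → ℝ := fun s ω =>
    ℓ / (4 * lam) * stepGain c (γ k) L (pairCols C s) (X k ω) (prox C f lam (X k ω)) (ξ k ω)
  have hΨm : ∀ s, Measurable[past X ξ pr k] (Ψ s) := fun s =>
    Measurable.const_mul ((continuous_stepGain c (γ k) L (pairCols C s)).measurable.comp
      ((hXσ.mono hσm le_rfl).prodMk ((hYσ.mono hσm le_rfl).prodMk hξm))) _
  obtain ⟨M, hM⟩ := exists_abs_stepGain_le (n := n) C c (γ k) L
  have hΨM : ∀ s ω, |Ψ s ω| ≤ ℓ / (4 * lam) * M := by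
    intro s ω
    rw [abs_mul, abs_of_nonneg hK]
    exact mul_le_mul_of_nonneg_left
      (hM s _ (hSt k ω) _ (h.prox_mem_stiefel (hSt k ω)) _ (hξL ω)) hK
  have havg : ∀ ω, ∑ s, Ψ s ω * (μ.map (pr k)).real {s} ≤
      9 * γ k ^ 2 * L ^ 2 / (2 * lam) + (ℓ - 2) * γ k ^ 4 * L ^ 4 / (2 * lam) -
      γ k / (2 * lam) * (ℓ / (2 * lam) - (τ + (2 * ℓ - 3) * L)) *
        blockQuad c (X k ω) (prox C f lam (X k ω) - X k ω) := fun ω => by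
    simp only [hX.map_pair_real, mul_comm (Ψ _ _)]
    exact h.avg_stepGain_le (hSt k ω) (hX.subgrad k ω) hγ
  set b : Ω → ℝ := fun ω => 9 * γ k ^ 2 * L ^ 2 / (2 * lam) +
    (ℓ - 2) * γ k ^ 4 * L ^ 4 / (2 * lam) -
      γ k / (2 * lam) * (ℓ / (2 * lam) - (τ + (2 * ℓ - 3) * L)) *
        blockQuad c (X k ω) (prox C f lam (X k ω) - X k ω) with hb
  have hbσ : Measurable[MeasurableSpace.comap (X k) inferInstance] b :=
    (Measurable.const_mul
      ((continuous_blockQuad_sub c).measurable.comp (hXσ.prodMk hYσ)) _).const_sub _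
  obtain ⟨M', hM'⟩ := ((isCompact_stiefel (Fin n) (Fin p)).prod
    (isCompact_stiefel (Fin n) (Fin p))).exists_bound_of_continuousOn
      (continuous_blockQuad_sub c).continuousOn
  have hbInt : Integrable b μ := by
    refine (integrable_const _).sub (Integrable.const_mul ?_ _)
    exact integrable_of_measurable_of_abs_le
      (((continuous_blockQuad_sub c).measurable.comp (hXσ.prodMk hYσ)).mono hXm le_rfl)
      (M := M') fun ω => hM' (X k ω, prox C f lam (X k ω))
        ⟨hSt k ω, h.prox_mem_stiefel (hSt k ω)⟩
  have heInt := hX.integrable_envelope h hX₀ k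
  have he1Int := hX.integrable_envelope h hX₀ (k + 1)
  have hebInt : Integrable ((fun ω => envelope C f lam (X k ω)) + b) μ := heInt.add hbInt
  have hsumInt : Integrable (∑ s, Ψ s * (pr k ⁻¹' {s}).indicator (1 : Ω → ℝ)) μ := by
    refine integrable_finsetSum' _ fun s _ => ?_
    have hms := hX.measurable_pair k (measurableSet_singleton s)
    refine ((integrable_const (1 : ℝ)).indicator hms).bdd_mul
      ((hΨm s).mono hm le_rfl).aestronglyMeasurable (c := ℓ / (4 * lam) * M)
      (Eventually.of_forall (hΨM s))
  have hstep : (fun ω => envelope C f lam (X (k + 1) ω)) ≤ᵐ[μ]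
      (fun ω => envelope C f lam (X k ω)) + ∑ s, Ψ s * (pr k ⁻¹' {s}).indicator (1 : Ω → ℝ) := by
    refine Eventually.of_forall fun ω => ?_
    have h1 := h.envelope_step_le (hSt k ω) (hX.subgrad k ω) hγ hγL (hX.step k ω)
    have h2 : (∑ s, Ψ s * (pr k ⁻¹' {s}).indicator (1 : Ω → ℝ)) ω = Ψ (pr k ω) ω := by
      rw [Finset.sum_apply, Finset.sum_eq_single (pr k ω)]
      · simp
      · intro s _ hs
        simp [Set.indicator, hs.symm]
      · simp
    change _ ≤ _ + (∑ s, Ψ s * (pr k ⁻¹' {s}).indicator (1 : Ω → ℝ)) ω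
    rw [h2]
    exact h1
  -- The past contains the current subgradient, which may be random, and is independent of the drawn
  -- pair; only the pair is averaged here.
  have h1 : μ[fun ω => envelope C f lam (X (k + 1) ω) | past X ξ pr k] ≤ᵐ[μ]
      (fun ω => envelope C f lam (X k ω)) + b := by
    have h2 := condExp_mono (m := past X ξ pr k) he1Int (heInt.add hsumInt) hstep
    have h3 := condExp_add heInt hsumInt (past X ξ pr k)
    have h4 := condExp_sum_indicator_mul hm (hX.measurable_pair k) (hX.indep k) hΨm hΨM
    have h5 := condExp_of_stronglyMeasurable hm (heσ.mono hσm le_rfl).stronglyMeasurable heInt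
    filter_upwards [h2, h3, h4] with ω h6 h7 h8
    rw [h7, Pi.add_apply, h8, h5] at h6
    exact h6.trans (by rw [Pi.add_apply]; gcongr; exact havg ω)
  -- The bound no longer involves the subgradient and depends on the current iterate alone, so the
  -- tower property passes to conditioning on that iterate.
  have h2 := condExp_mono (m := MeasurableSpace.comap (X k) inferInstance)
    integrable_condExp hebInt h1
  have h3 := condExp_condExp_of_le (μ := μ) (f := fun ω => envelope C f lam (X (k + 1) ω)) hσm hm
  have h4 := condExp_of_stronglyMeasurable hXm (heσ.add hbσ).stronglyMeasurable hebInt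
  filter_upwards [h2, h3] with ω h5 h6
  rw [h6] at h5
  refine h5.trans (le_of_eq ?_)
  exact congrFun h4 ω

end Iterates

end RSSM

end

/-! ### The stationarity estimate -/

open RSSM
theorem proposition4p9 {n p ℓ : ℕ} (hp : 1 ≤ p) (hpn : p ≤ n) (hℓ : 2 ≤ ℓ)
    (C : Fin ℓ → Finset (Fin p)) (hC : IsPartition C)
    (f : Matrix (Fin n) (Fin p) ℝ → ℝ) (U : Set (Matrix (Fin n) (Fin p) ℝ)) (τ L : ℝ)
    (hUb : Bornology.IsBounded U) (hUc : Convex ℝ U)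
    (hUn : U ∈ 𝓝ˢ (Stiefel (Fin n) (Fin p)))
    (hτ : 0 ≤ τ) (hf : WeaklyConvexOn τ U f)
    (hL : 0 < L) (hfL : ∀ X ∈ U, ∀ Y ∈ U, |f X - f Y| ≤ L * ‖X - Y‖)
    (γ : ℕ → ℝ) (hγ : ∀ k, 0 < γ k ∧ γ k < 1 / L)
    (X₀ : Matrix (Fin n) (Fin p) ℝ) (hX₀ : X₀ ∈ Stiefel (Fin n) (Fin p))
    {Ω : Type*} [MeasurableSpace Ω] (μ : Measure Ω) [IsProbabilityMeasure μ]
    (X ξ : ℕ → Ω → Matrix (Fin n) (Fin p) ℝ) (pr : ℕ → Ω → BlockPair ℓ)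
    (hX : IsIterates μ f C γ X₀ X ξ pr)
    (lam : ℝ) (hlam : 0 < lam) (hlam' : lam < ℓ / (2 * (τ + (2 * ℓ - 1) * L))) (k : ℕ) :
    -- the adaptive proximal map is single-valued on the Stiefel manifold
    (∀ Y ∈ Stiefel (Fin n) (Fin p), proxSet C f lam Y = {prox C f lam Y}) ∧
    -- the conditional expectation is that of an integrable random variable
    Integrable (fun ω => envelope C f lam (X (k + 1) ω)) μ ∧
    ∀ᵐ ω ∂μ,
      γ k * surrogate C f lam (X k ω) ^ 2 =
        γ k / lam ^ 2 * adaptiveNorm C (X k ω) (prox C f lam (X k ω) - X k ω) ^ 2 ∧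
      γ k * surrogate C f lam (X k ω) ^ 2 ≤
        (envelope C f lam (X k ω) -
            (μ[fun ω' => envelope C f lam (X (k + 1) ω') |
              MeasurableSpace.comap (X k) inferInstance]) ω +
            9 * γ k ^ 2 * L ^ 2 / (2 * lam) +
            2 * (ℓ - 2) * γ k ^ 3 * L ^ 3 / lam +
            (ℓ - 2) * γ k ^ 4 * L ^ 4 / (2 * lam)) /
          (lam / ℓ * (ℓ / (2 * lam) - (τ + (2 * ℓ - 3) * L))) := by
  obtain ⟨c, hc⟩ := hC.exists_index
  have h : ProxSetting C c f U τ L lam :=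
    { two_le := hℓ
      mem_block := hc
      nhds := fun Y hY => mem_nhdsSet_iff_forall.1 hUn Y hY
      tau_nonneg := hτ
      weaklyConvex := hf
      lip_pos := hL
      lipschitz := hfL
      lam_pos := hlam
      lam_lt := hlam' }
  have hγ0 := (hγ k).1
  have hγL : γ k * L ≤ 1 := by
    have := (hγ k).2
    rw [lt_div_iff₀ hL] at this
    exact this.le
  refine ⟨fun Y hY => h.proxSet_eq_singleton hY, hX.integrable_envelope h hX₀ (k + 1), ?_⟩
  filter_upwards [hX.condExp_envelope_le h hX₀ k hγ0.le hγL] with ω hω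
  have h2 := h.two_le_cast
  have hw : 0 < ℓ / (2 * lam) - (τ + (2 * ℓ - 3) * L) := by
    have := h.modulus_pos
    linarith
  have hs := hX.mem_stiefel hX₀ k ω
  refine ⟨by rw [surrogate]; ring, ?_⟩
  rw [surrogate, mul_pow, adaptiveNorm_sq hc hℓ hs, le_div_iff₀ (by positivity)]
  -- The estimate holds without the cubic term; being nonnegative, it can be added.
  have h3 : 0 ≤ 2 * ((ℓ : ℝ) - 2) * γ k ^ 3 * L ^ 3 / lam := by
    have : (0 : ℝ) ≤ ℓ - 2 := by linarith
    positivity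
  generalize ((ℓ : ℝ) / (2 * lam) - (τ + (2 * ℓ - 3) * L)) = w at *
  have h0 : (0 : ℝ) < ℓ := by linarith
  have h4 : γ k * ((1 / lam) ^ 2 * (ℓ / 2 * blockQuad c (X k ω) (prox C f lam (X k ω) - X k ω))) *
      (lam / ℓ * w) =
      γ k / (2 * lam) * w * blockQuad c (X k ω) (prox C f lam (X k ω) - X k ω) := by
    field_simp
  rw [h4]
  linarith
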